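/- **Setting.** Let $G$ be a finite group and $\omega:G^3\to U(1)$ a 3-cocycle (not necessarily normalised), $\omega(h,k,l)\,\omega(g,hk,l)\,\omega(g,h,k)=\omega(gh,k,l)\,\omega(g,h,kl)$. Put $$\theta_x(g,h)=\frac{\omega(x,g,h)\,\omega(g,h,(gh)^{-1}xgh)}{\omega(g,g^{-1}xg,h)},\qquad \gamma_g(x,y)=\frac{\omega(x,y,g)\,\omega(g,g^{-1}xg,g^{-1}yg)}{\omega(x,g,g^{-1}yg)} .$$ Consider an oriented triangulated surface with a branching structure: every edge is directed, every triangle $\Delta$ has ordered vertices $1\to2\to3$ and an orientation sign $s(\Delta)=\pm1$. Its Hilbert space has the orthonormal basis $|\{g_v\},\{h_e\}\rangle$ with $g_v\in G$ at the vertices and $h_e=h_{ij}\in G$ on the edges $e:j\to i$. Write $\hat g_{ij}=g_ih_{ij}g_j^{-1}$. The gauge transformation $G^x_v$ maps $g_v\mapsto g_vx^{-1}$, multiplies the labels of the edges flowing to $v$ by $x$ on the left and those of the edges emanating from $v$ by $x^{-1}$ on the right; $G^x_{\mathcal R}=\prod_{v\in\mathcal R}G^x_v$. Let $$|\Psi\rangle=\sum_{\{g_v\}}\prod_\Delta\omega(g_3g_2^{-1},g_2g_1^{-1},g_1)^{s(\Delta)}\,|\{g_v\},\{h_e=1\}\rangle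 .$$ Let $\mathcal R$ be a region in the interior of the surface (all surface edges that meet $\mathcal R$ are sides of two triangles, and each edge between vertices of $\mathcal R$ is a side of a triangle of $\mathcal R$) whose oriented boundary $\partial\mathcal R$ is a simple loop with branching structure $1\to2\to\cdots\to n\leftarrow1$, $n\ge3$, containing every vertex of $\mathcal R$ that is joined to the outside. The triangles and edges *crossed by* $\partial\mathcal R$ are those with a vertex in $\mathcal R$ and a vertex outside. Let $h_{k,1}^{\mathrm{path}}=h_{k,k-1}\cdots h_{2,1}$, let $h=h_{n,n-1}\cdots h_{2,1}h_{n,1}^{-1}$ be the holonomy, let $x_k$ be $x\in G$ transported from vertex $n$ to vertex $k$, i.e. $x_k=h_{kn}xh_{kn}^{-1}$ with $h_{kn}=(h_{n,n-1}\cdots h_{k+1,k})^{-1}$, and put $X_k=g_kx_kg_k^{-1}$. Define, on basis states: * $\mathcal L^x_{\partial\mathcal R}$: multiplies the label of each crossed edge by $x_k$ on the left if it flows to the vertex $k$ of $\partial\mathcal R$, and by $x_k^{-1}$ on the right if it emanates from $k$; * $W^x$: the product, over the triangles $\Delta=(1\to2\to3)$ crossed by $\partial\mathcal R$, of the $s(\Delta)$-th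 power of the cocycles of the prism obtained by lifting the vertices in $\mathcal R$, $i\mapsto i'$, with $g_{i'}=g_i$ and $h_{i'i}=x_i$, that is of $$\omega(X_3,\hat g_{32},\hat g_{21})^{[3\in\mathcal R]}\;\omega(\hat g'_{32},X_2,\hat g_{21})^{-[2\in\mathcal R]}\;\omega(\hat g'_{32},\hat g'_{21},X_1)^{[1\in\mathcal R]},$$ where $\hat g'$ is $\hat g$ after $\mathcal L^x_{\partial\mathcal R}$; * $\tilde\Theta^x=\prod_{k=3}^{n}\theta_{X_k}\big(\hat g_{k,k-1},\,g_{k-1}h^{\mathrm{path}}_{k-1,1}g_1^{-1}\big)$ and $\Theta^x=\tilde\Theta^x\,\theta_{X_n}\big(g_nhg_n^{-1},\hat g_{n,1}\big)^{-1}$; * the branch line operators $\tilde{\mathcal B}^x=\mathcal L^x_{\partial\mathcal R}W^x\tilde\Theta^x$ and $\mathcal B^{x,g}=\mathcal L^x_{\partial\mathcal R}W^x\Theta^x\,\delta_{g,\,g_nhg_n^{-1}}$. **Theorem.** For all $x,y,g,g'\in G$: 1. $\theta_g(x,y)\,\theta_{g'}(x,y)\,\gamma_x(g,g')\,\gamma_y(x^{-1}gx,x^{-1}g'x)=\theta_{gg'}(x,y)\,\gamma_{xy}(g,g')$.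 2. $\tilde{\mathcal B}^x$ is supported on the vertices and edges of $\partial\mathcal R$ and of the triangles crossed by $\partial\mathcal R$, and $\tilde{\mathcal B}^x|\Psi\rangle=G^x_{\mathcal R}|\Psi\rangle$. 3. $\tilde{\mathcal B}^x\tilde{\mathcal B}^y=\tilde{\mathcal B}^{xy}$ on all states with trivial edges ($h_e=1$ for all $e$), and more generally on all states for which the triangles crossed by $\partial\mathcal R$ carry no flux ($h_{32}h_{21}=h_{31}$) and $h=1$. 4. On all states for which the triangles crossed by $\partial\mathcal R$ carry no flux and the holonomy $h$ commutes with $x$ and $y$, $$\mathcal B^{x,g}\,\mathcal B^{y,g'}=\delta_{g,g'}\;\mathcal B^{xy,g}\;\gamma_g\big(g_nxg_n^{-1},\,g_nyg_n^{-1}\big).$$ -/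

import Mathlib

/-! ### Cocycles and slant products -/

/-- `ω` is a 3-cocycle of `G` with values in `U(1)` (trivial action, no normalisation). -/
def IsThreeCocycle {G : Type*} [Group G] (ω : G → G → G → Circle) : Prop :=
  ∀ g h k l : G,
    ω h k l * ω g (h * k) l * ω g h k = ω (g * h) k l * ω g h (k * l)

/-- The slant product `θ_x(g,h) = ω(x,g,h) ω(g,h,(gh)⁻¹xgh) / ω(g,g⁻¹xg,h)`. -/
noncomputable def slantTheta {G : Type*} [Group G] (ω : G → G → G → Circle) (x g h : G) :
    Circle :=
  ω x g h * ω g h ((g * h)⁻¹ * x * (g * h)) / ω g (g⁻¹ * x * g) h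

/-- The product `γ_g(x,y) = ω(x,y,g) ω(g,g⁻¹xg,g⁻¹yg) / ω(x,g,g⁻¹yg)`. -/
noncomputable def slantGamma {G : Type*} [Group G] (ω : G → G → G → Circle) (g x y : G) :
    Circle :=
  ω x y g * ω g (g⁻¹ * x * g) (g⁻¹ * y * g) / ω x g (g⁻¹ * y * g)

/-! ### Oriented triangulated lattices with a branching structure -/

/-- An oriented triangulated surface with a branching structure, possibly with boundary.
`V`, `E`, `F` are the vertices, edges and triangles. The edge `e` runs from `src e` to `tgt e`.
A triangle has ordered vertices `1 → 2 → 3`, and `face Δ i` is its edge opposite to the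
`i`-th vertex (counted from `0`), so `face Δ 2 = (1 → 2)`, `face Δ 0 = (2 → 3)` and
`face Δ 1 = (1 → 3)`. `sign Δ` is the orientation `s(Δ)`.
The field `opposite` says that the orientation is coherent, and implies that an edge is a side of
at most two triangles. No condition on vertex links is imposed. -/
structure BranchedTriangulation (V E F : Type*) where
  src : E → V
  tgt : E → V
  face : F → Fin 3 → E
  src_face_zero : ∀ Δ, src (face Δ 0) = tgt (face Δ 2)
  tgt_face_zero : ∀ Δ, tgt (face Δ 0) = tgt (face Δ 1)
  src_face_one : ∀ Δ, src (face Δ 1) = src (face Δ 2)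
  sign : F → ℤˣ
  opposite : ∀ Δ i Δ' j, face Δ i = face Δ' j → (Δ, i) ≠ (Δ', j) →
    (sign Δ : ℤ) * (-1) ^ (i : ℕ) = -((sign Δ' : ℤ) * (-1) ^ (j : ℕ))

namespace BranchedTriangulation

variable {V E F : Type*} (T : BranchedTriangulation V E F)

/-- First vertex of a triangle `1 → 2 → 3`. -/
def v1 (Δ : F) : V := T.src (T.face Δ 2)

/-- Second vertex of a triangle `1 → 2 → 3`. -/
def v2 (Δ : F) : V := T.tgt (T.face Δ 2)

/-- Third vertex of a triangle `1 → 2 → 3`. -/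
def v3 (Δ : F) : V := T.tgt (T.face Δ 0)

/-- All three vertices of the triangle lie in the region. -/
def InRegion (R : Finset V) (Δ : F) : Prop := T.v1 Δ ∈ R ∧ T.v2 Δ ∈ R ∧ T.v3 Δ ∈ R

/-- The triangle is crossed by `∂R`: it has a vertex in `R` and a vertex outside `R`. These are
the plaquettes on `∂R`. -/
def Crosses (R : Finset V) (Δ : F) : Prop :=
  (T.v1 Δ ∈ R ∨ T.v2 Δ ∈ R ∨ T.v3 Δ ∈ R) ∧ ¬ (T.v1 Δ ∈ R ∧ T.v2 Δ ∈ R ∧ T.v3 Δ ∈ R)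

/-- The edge is crossed by `∂R`: exactly one of its end points is in `R`. -/
def EdgeCrosses (R : Finset V) (e : E) : Prop := Xor (T.src e ∈ R) (T.tgt e ∈ R)

instance [DecidableEq V] (R : Finset V) (Δ : F) : Decidable (T.InRegion R Δ) := by
  unfold InRegion; infer_instance

instance [DecidableEq V] (R : Finset V) (Δ : F) : Decidable (T.Crosses R Δ) := by
  unfold Crosses; infer_instance

/-- The coefficient of the edge `e` in the oriented boundary `∂(∑_{Δ ⊂ R} s(Δ) Δ)`. -/
def boundaryCoeff [Fintype F] [DecidableEq V] [DecidableEq E] (R : Finset V) (e : E) : ℤ :=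
  ∑ Δ : F, ∑ i : Fin 3,
    if T.InRegion R Δ ∧ T.face Δ i = e then (T.sign Δ : ℤ) * (-1) ^ (i : ℕ) else 0

/-- The set `R` of vertices is a region in the interior of the surface, and `∂R` is a simple
closed loop with branching structure `1 → 2 → ⋯ → n ← 1` and `n = m + 1 ≥ 3` vertices, which are
numbered here from `0` to `m`. -/
structure BoundaryLoop [Fintype F] [DecidableEq V] [DecidableEq E] (R : Finset V) where
  m : ℕ
  two_le : 2 ≤ m
  vtx : Fin (m + 1) → V
  vtx_injective : Function.Injective vtx
  vtx_mem : ∀ k, vtx k ∈ R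
  /-- the edges `k → k + 1` -/
  edge : Fin m → E
  src_edge : ∀ k, T.src (edge k) = vtx k.castSucc
  tgt_edge : ∀ k, T.tgt (edge k) = vtx k.succ
  /-- the edge `1 → n` -/
  closing : E
  src_closing : T.src closing = vtx 0
  tgt_closing : T.tgt closing = vtx (Fin.last m)
  /-- the oriented boundary of the region is the loop -/
  boundary_eq : ∀ e, T.boundaryCoeff R e =
    (∑ k : Fin m, if edge k = e then (1 : ℤ) else 0) - (if closing = e then 1 else 0)
  /-- every vertex of `R` that is joined to the outside is on the loop -/
  mem_loop : ∀ e, T.EdgeCrosses R e → ∀ v ∈ R, (v = T.src e ∨ v = T.tgt e) → ∃ k, vtx k = v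
  /-- every edge between vertices of `R` belongs to a triangle of `R` -/
  full : ∀ e, T.src e ∈ R → T.tgt e ∈ R → ∃ Δ i, T.InRegion R Δ ∧ T.face Δ i = e
  /-- every edge that meets `R` is interior to the surface: it is a side of two triangles -/
  interior : ∀ e, (T.src e ∈ R ∨ T.tgt e ∈ R) →
    ∃ Δ i Δ' j, (Δ, i) ≠ (Δ', j) ∧ T.face Δ i = e ∧ T.face Δ' j = e

end BranchedTriangulation

/-! ### States and operators -/

/-- Labels `g_v` on the vertices and `h_e` on the edges (`h_e = h_{ij}` for an edge `j → i`). -/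
abbrev Config (V E G : Type*) := (V → G) × (E → G)

/-- The Hilbert space `⨂_v ℂ[G] ⊗ ⨂_e ℂ[G]`, with the configurations as orthonormal basis. -/
abbrev LatticeState (V E G : Type*) := EuclideanSpace ℂ (Config V E G)

section Operators

variable {V E F G : Type*} [Fintype V] [DecidableEq V] [Fintype E] [DecidableEq E]
  [Fintype G] [DecidableEq G]

/-- The basis state `|{g_v}, {h_e}⟩`. -/
noncomputable def ket (c : Config V E G) : LatticeState V E G := EuclideanSpace.single c 1

/-- The linear operator with prescribed values on the basis states. -/
noncomputable def opOfKets (A : Config V E G → LatticeState V E G) :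
    Module.End ℂ (LatticeState V E G) :=
  (EuclideanSpace.basisFun (Config V E G) ℂ).toBasis.constr ℂ A

/-- The operator `|c⟩ ↦ |f c⟩`. -/
noncomputable def relabelOp (f : Config V E G → Config V E G) :
    Module.End ℂ (LatticeState V E G) :=
  opOfKets fun c => ket (f c)

/-- The diagonal operator `|c⟩ ↦ φ(c) |c⟩`. -/
noncomputable def diagOp (φ : Config V E G → ℂ) : Module.End ℂ (LatticeState V E G) :=
  opOfKets fun c => φ c • ket c


theorem opOfKets_ket (A : Config V E G → LatticeState V E G) (c : Config V E G) :
    opOfKets A (ket c) = A c := by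
  have h : ket c = (EuclideanSpace.basisFun (Config V E G) ℂ).toBasis c := by
    simp [ket]
  rw [opOfKets, h, Module.Basis.constr_basis]

theorem relabelOp_commute {f f' : Config V E G → Config V E G}
    (h : ∀ c, f (f' c) = f' (f c)) : Commute (relabelOp f) (relabelOp f') := by
  refine (EuclideanSpace.basisFun (Config V E G) ℂ).toBasis.ext fun c => ?_
  have hc : (EuclideanSpace.basisFun (Config V E G) ℂ).toBasis c = ket c := by
    simp [ket]
  rw [hc]
  simp only [Module.End.mul_apply, relabelOp, opOfKets_ket, h]

/-- `A` acts only on the degrees of freedom at the vertices `DV` and the edges `DE`, that is,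
`A = A_D ⊗ 1`, expressed through matrix elements. -/
def IsSupportedOn (A : Module.End ℂ (LatticeState V E G)) (DV : Set V) (DE : Set E) : Prop :=
  (∀ c c' : Config V E G, (A (ket c)) c' ≠ 0 → Set.EqOn c.1 c'.1 DVᶜ ∧ Set.EqOn c.2 c'.2 DEᶜ) ∧
  (∀ c c' d d' : Config V E G,
    Set.EqOn c.1 d.1 DV → Set.EqOn c.2 d.2 DE → Set.EqOn c'.1 d'.1 DV → Set.EqOn c'.2 d'.2 DE →
    Set.EqOn c.1 c'.1 DVᶜ → Set.EqOn c.2 c'.2 DEᶜ →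
    Set.EqOn d.1 d'.1 DVᶜ → Set.EqOn d.2 d'.2 DEᶜ →
    (A (ket c)) c' = (A (ket d)) d')

namespace BranchedTriangulation

variable [Group G] (T : BranchedTriangulation V E F)

/-! ### Gauge transformations -/

/-- Gauge transformation at `v`: `g_v ↦ g_v x⁻¹`, left multiplication by `x` on the edges that
flow to `v`, right multiplication by `x⁻¹` on those that emanate from `v`. -/
def gaugeConfig (v : V) (x : G) (c : Config V E G) : Config V E G :=
  (fun w => if w = v then c.1 w * x⁻¹ else c.1 w,
   fun e => (if T.tgt e = v then x else 1) * c.2 e * (if T.src e = v then x⁻¹ else 1))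

/-- The operator `G^x_v`. -/
noncomputable def gaugeOp (v : V) (x : G) : Module.End ℂ (LatticeState V E G) :=
  relabelOp (T.gaugeConfig v x)

theorem gaugeOp_commute {v w : V} (hvw : v ≠ w) (x y : G) :
    Commute (T.gaugeOp v x) (T.gaugeOp w y) := by
  refine relabelOp_commute fun c => ?_
  refine Prod.ext ?_ ?_
  · funext u
    by_cases h1 : u = v
    · subst h1; simp [gaugeConfig, hvw]
    · simp [gaugeConfig, h1]
  · funext e
    by_cases h1 : T.tgt e = v
    · have h2 : T.tgt e ≠ w := fun h => hvw (h1.symm.trans h)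
      by_cases h3 : T.src e = v
      · have h4 : T.src e ≠ w := fun h => hvw (h3.symm.trans h)
        simp [gaugeConfig, h1, h3, hvw]
      · simp [gaugeConfig, h1, h3, hvw, mul_assoc]
    · by_cases h3 : T.src e = v
      · simp [gaugeConfig, h1, h3, hvw, mul_assoc]
      · simp [gaugeConfig, h1, h3]

/-- The operator `G^x_R = ∏_{v ∈ R} G^x_v`. -/
noncomputable def gaugeRegionOp (R : Finset V) (x : G) : Module.End ℂ (LatticeState V E G) :=
  R.noncommProd (fun v => T.gaugeOp v x) fun _ _ _ _ h => T.gaugeOp_commute h x x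

variable [Fintype F]

/-- The state `|Ψ_SPT⟩ ⊗ ⨂_e |1⟩_e`, where
`|Ψ_SPT⟩ = ∑_g ∏_Δ ω(g₃g₂⁻¹, g₂g₁⁻¹, g₁)^{s(Δ)} |g⟩`. -/
noncomputable def sptPreState (ω : G → G → G → Circle) : LatticeState V E G :=
  ∑ g : V → G,
    ((∏ Δ : F, ω (g (T.v3 Δ) * (g (T.v2 Δ))⁻¹) (g (T.v2 Δ) * (g (T.v1 Δ))⁻¹) (g (T.v1 Δ))
      ^ (T.sign Δ : ℤ) : Circle) : ℂ) • ket (g, fun _ => 1)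

/-- The gauge invariant combination `g_i h_{ij} g_j⁻¹` on the edge `e : j → i`. -/
def edgeVar (c : Config V E G) (e : E) : G := c.1 (T.tgt e) * c.2 e * (c.1 (T.src e))⁻¹

namespace BoundaryLoop

variable {T} {R : Finset V} (b : T.BoundaryLoop R)

/-! ### The loop, its holonomy, and the transport of `x` along it -/

/-- The reference vertex `v = n`. -/
def ref : V := b.vtx (Fin.last b.m)

/-- The product `h_{k,k-1} ⋯ h_{2,1}` of the edge labels from the first vertex to vertex `k`. -/
def path (c : Config V E G) : Fin (b.m + 1) → G :=
  Fin.induction (motive := fun _ => G) 1 fun i p => c.2 (b.edge i) * p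

/-- The holonomy `h = h_{n,n-1} ⋯ h_{2,1} h_{n,1}⁻¹` along `∂R`, based at vertex `n`. -/
def holonomy (c : Config V E G) : G := b.path c (Fin.last b.m) * (c.2 b.closing)⁻¹

/-- `x` transported from vertex `n` to vertex `k` along the loop, `h_{kn} x h_{kn}⁻¹` with
`h_{kn} = (h_{n,n-1} ⋯ h_{k+1,k})⁻¹`. -/
def transportAt (x : G) (c : Config V E G) (k : Fin (b.m + 1)) : G :=
  (b.path c k * (b.path c (Fin.last b.m))⁻¹) * x *
    (b.path c k * (b.path c (Fin.last b.m))⁻¹)⁻¹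

/-- The transported element at a vertex of the loop (`1` at the other vertices, where it is never
used). -/
noncomputable def transport (x : G) (c : Config V E G) : V → G :=
  Function.extend b.vtx (b.transportAt x c) fun _ => 1

/-- The gauge invariant combination `g_v x_v g_v⁻¹`, where `x_v` is `x` transported to `v`. -/
noncomputable def lift (x : G) (c : Config V E G) (v : V) : G :=
  c.1 v * b.transport x c v * (c.1 v)⁻¹

/-- `𝓛^x_{∂R}` on configurations: the edges crossed by `∂R` are shifted by the transported `x`,
on the left if they flow into `R` and by its inverse on the right if they emanate from `R`. -/
noncomputable def shift (x : G) (c : Config V E G) : Config V E G :=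
  (c.1, fun e =>
    if T.tgt e ∈ R ∧ T.src e ∉ R then b.transport x c (T.tgt e) * c.2 e
    else if T.src e ∈ R ∧ T.tgt e ∉ R then c.2 e * (b.transport x c (T.src e))⁻¹
    else c.2 e)

/-- The operator `𝓛^x_{∂R}`. -/
noncomputable def shiftOp (x : G) : Module.End ℂ (LatticeState V E G) := relabelOp (b.shift x)

/-! ### The phases -/

/-- The cocycles of the tetrahedra above a triangle `1 → 2 → 3` when its vertices in `R` are
lifted to `v'` with `g_{v'} = g_v` and `h_{v'v} = x_v`. The prism above it is cut into the
tetrahedra `(1,2,3,3')`, `(1,2,2',3')`, `(1,1',2',3')` with signs `+,-,+`; the one that contains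
the edge `i → i'` is present if `i ∈ R`, and in it a later vertex `j` that is not in `R` is not
lifted. The tetrahedron `(a,b,c,d)` has the cocycle `ω(ĝ_{dc}, ĝ_{cb}, ĝ_{ba})` of the gauge
invariant edge variables; the edges of the upper surface carry the shifted configuration. -/
noncomputable def trianglePhase (ω : G → G → G → Circle) (x : G) (c : Config V E G) (Δ : F) :
    Circle :=
  (if T.v3 Δ ∈ R then
      ω (b.lift x c (T.v3 Δ)) (T.edgeVar c (T.face Δ 0)) (T.edgeVar c (T.face Δ 2)) else 1) *
  (if T.v2 Δ ∈ R then
      ω (T.edgeVar (b.shift x c) (T.face Δ 0)) (b.lift x c (T.v2 Δ))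
        (T.edgeVar c (T.face Δ 2)) else 1)⁻¹ *
  (if T.v1 Δ ∈ R then
      ω (T.edgeVar (b.shift x c) (T.face Δ 0)) (T.edgeVar (b.shift x c) (T.face Δ 2))
        (b.lift x c (T.v1 Δ)) else 1)

/-- The phase `W_{∂R}`: the product of the cocycles of the tetrahedra over the triangles crossed
by `∂R`. For trivial edges it is the phase `W̃_{∂R}`. -/
noncomputable def phaseW (ω : G → G → G → Circle) (x : G) (c : Config V E G) : Circle :=
  ∏ Δ : F, if T.Crosses R Δ then b.trianglePhase ω x c Δ ^ (T.sign Δ : ℤ) else 1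

/-- The phase `Θ̃_{∂R} = ∏_{k=3}^{n} θ_{g_k x g_k⁻¹}(g_k g_{k-1}⁻¹, g_{k-1} g_1⁻¹)`, with the edge
labels inserted so that it is gauge invariant. -/
noncomputable def phaseThetaTilde (ω : G → G → G → Circle) (x : G) (c : Config V E G) : Circle :=
  ∏ k : Fin b.m, if 0 < (k : ℕ) then
    slantTheta ω (b.lift x c (b.vtx k.succ)) (T.edgeVar c (b.edge k))
      (c.1 (b.vtx k.castSucc) * b.path c k.castSucc * (c.1 (b.vtx 0))⁻¹)
  else 1

/-- The holonomy `g_n h g_n⁻¹`. -/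
def dressedHolonomy (c : Config V E G) : G := c.1 b.ref * b.holonomy c * (c.1 b.ref)⁻¹

/-- The phase `Θ_{∂R}`, which has the additional factor
`θ_{g_n x g_n⁻¹}(g_n h g_n⁻¹, g_n h_{n,1} g_1⁻¹)⁻¹`. -/
noncomputable def phaseTheta (ω : G → G → G → Circle) (x : G) (c : Config V E G) : Circle :=
  b.phaseThetaTilde ω x c *
    (slantTheta ω (b.lift x c b.ref) (b.dressedHolonomy c) (T.edgeVar c b.closing))⁻¹

/-! ### The symmetry branch line operators -/

/-- The operator `B̃^x_{∂R} = 𝓛^x W̃ Θ̃`. -/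
noncomputable def branchLineTilde (ω : G → G → G → Circle) (x : G) :
    Module.End ℂ (LatticeState V E G) :=
  b.shiftOp x * diagOp fun c => ((b.phaseW ω x c * b.phaseThetaTilde ω x c : Circle) : ℂ)

/-- The operator `B^{x,g}_{∂R} = 𝓛^x W Θ δ_{g, g_n h g_n⁻¹}`. -/
noncomputable def branchLine (ω : G → G → G → Circle) (x g : G) :
    Module.End ℂ (LatticeState V E G) :=
  b.shiftOp x * diagOp fun c =>
    ((b.phaseW ω x c * b.phaseTheta ω x c : Circle) : ℂ) *
      (if g = b.dressedHolonomy c then 1 else 0)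

/-- The diagonal operator `γ_g(g_n x g_n⁻¹, g_n y g_n⁻¹)`. -/
noncomputable def gammaOp (ω : G → G → G → Circle) (g x y : G) :
    Module.End ℂ (LatticeState V E G) :=
  diagOp fun c =>
    (slantGamma ω g (c.1 b.ref * x * (c.1 b.ref)⁻¹) (c.1 b.ref * y * (c.1 b.ref)⁻¹) : ℂ)

/-- The vertices of the loop and of the triangles crossed by `∂R`. -/
def supportVertices : Set V :=
  Set.range b.vtx ∪ {v | ∃ Δ, T.Crosses R Δ ∧ (v = T.v1 Δ ∨ v = T.v2 Δ ∨ v = T.v3 Δ)}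

/-- The edges of the loop and of the triangles crossed by `∂R`. -/
def supportEdges : Set E :=
  Set.range b.edge ∪ {b.closing} ∪ {e | ∃ Δ i, T.Crosses R Δ ∧ T.face Δ i = e}

/-! ### The subspaces on which the multiplication rules hold -/

/-- The triangles crossed by `∂R` carry no flux. -/
def FlatNearLoop (T : BranchedTriangulation V E F) (R : Finset V) (c : Config V E G) : Prop :=
  ∀ Δ : F, T.Crosses R Δ → c.2 (T.face Δ 0) * c.2 (T.face Δ 2) = c.2 (T.face Δ 1)

/-- States with trivial pre-gauge edges, `h_e = 1` for all `e`. -/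
def trivialEdgeStates (V E G : Type*) [Fintype V] [DecidableEq V] [Fintype E] [DecidableEq E]
    [Fintype G] [DecidableEq G] [Group G] : Submodule ℂ (LatticeState V E G) :=
  Submodule.span ℂ {ψ | ∃ g : V → G, ψ = ket (g, fun _ => 1)}

/-- States without flux on the triangles crossed by `∂R` and with trivial holonomy along `∂R`. -/
def fluxFreeStates : Submodule ℂ (LatticeState V E G) :=
  Submodule.span ℂ {ψ | ∃ c, FlatNearLoop T R c ∧ b.holonomy c = 1 ∧ ψ = ket c}

/-- States without flux on the triangles crossed by `∂R` whose holonomy along `∂R` commutes with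
`x` and `y`. -/
def centralFluxStates (x y : G) : Submodule ℂ (LatticeState V E G) :=
  Submodule.span ℂ
    {ψ | ∃ c, FlatNearLoop T R c ∧ Commute x (b.holonomy c) ∧ Commute y (b.holonomy c) ∧
      ψ = ket c}

end BoundaryLoop

end BranchedTriangulation

end Operators

/-! ### Slant products as sums over shuffles of cocycle relations -/

section SlantProducts

variable {G : Type*} [Group G] {ω : G → G → G → Circle}

/-! A value of `ω` is the weight of a tetrahedron, and a cocycle relation is the boundary relation
of a 4-simplex. Every phase identity below comes from cutting a prism into simplices. What remains
is a coboundary on the edges, and discrete Stokes moves it to the loop.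

The gauge transformation sends `|g⟩` to the state with `g` multiplied by `x⁻¹` on the region. Hence
item 2 compares the amplitude at `g` with that at `g` multiplied on the right by `x` on the region.
A triangle amplitude is the cone over the triangle with apex of label `1`. Lifting its vertices in
the region multiplies it by the prism over the triangle and by a coboundary of cone faces
(`cocycle_lift_eq_prismPhase_mul`). The latter has product `1`, because every edge meeting the
region has two sides of opposite sign. The prisms over crossed triangles form `W`. A prism over a
triangle of the region is a slant product `θ`, which is a 2-cocycle (`slantTheta_cocycle`); its
primitive based at the first loop vertex turns the product over the region into `Θ̃`
(`prod_edgeTheta`).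

For items 3 and 4, lifting by `y` and then by `x` agrees with lifting by `xy` up to a coboundary
(`prismPhase_mul_prismPhase`). By Stokes, `W` is multiplicative up to the product of the `γ` of the
loop edges divided by the `γ` of the closing edge (`phaseW_mul`). Item 1
(`slantTheta_mul_slantGamma`) makes the defect of `Θ̃` telescope to the `γ` of the whole path
divided by the same product (`phaseThetaTilde_mul`). Together they leave `γ` of the path over `γ` of
the closing edge. This is `1` if `h = 1`. In general the path is the holonomy times the closing
edge, so item 1 once more, with the extra factor of `Θ`, leaves the `γ` of the holonomy. -/

open Additive in
theorem IsThreeCocycle.ofMul_eq (hω : IsThreeCocycle ω) (g h k l : G) {gh hk kl : G}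
    (h₁ : g * h = gh) (h₂ : h * k = hk) (h₃ : k * l = kl) :
    ofMul (ω h k l) + ofMul (ω g hk l) + ofMul (ω g h k) =
      ofMul (ω gh k l) + ofMul (ω g h kl) := by
  subst h₁ h₂ h₃
  simpa only [ofMul_mul] using congrArg ofMul (hω g h k l)

theorem slantTheta_eq_of_conj {x g h xg xgh : G} (h₁ : g * xg = x * g) (h₂ : h * xgh = xg * h) :
    slantTheta ω x g h = ω x g h * ω g h xgh / ω g xg h := by
  have e₁ : g⁻¹ * x * g = xg := by rw [mul_assoc, ← h₁, inv_mul_cancel_left]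
  have e₂ : (g * h)⁻¹ * x * (g * h) = xgh := by
    rw [mul_inv_rev, mul_assoc, ← mul_assoc x g h, ← h₁, mul_assoc g, ← h₂]
    group
  rw [slantTheta, e₁, e₂]

theorem slantGamma_eq_of_conj {g x y xg yg : G} (h₁ : g * xg = x * g) (h₂ : g * yg = y * g) :
    slantGamma ω g x y = ω x y g * ω g xg yg / ω x g yg := by
  have e₁ : g⁻¹ * x * g = xg := by rw [mul_assoc, ← h₁, inv_mul_cancel_left]
  have e₂ : g⁻¹ * y * g = yg := by rw [mul_assoc, ← h₂, inv_mul_cancel_left]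
  rw [slantGamma, e₁, e₂]

theorem mul_conj_inv_mul (x g : G) : g * (g⁻¹ * x * g) = x * g := by group

open Additive in
/-- The slant product intertwines the products of `G` and of the transformation groupoid. -/
theorem slantTheta_mul_slantGamma (hω : IsThreeCocycle ω) (g h x y : G) :
    slantTheta ω g x y * slantTheta ω h x y * slantGamma ω x g h *
        slantGamma ω y (x⁻¹ * g * x) (x⁻¹ * h * x) =
      slantTheta ω (g * h) x y * slantGamma ω (x * y) g h := by
  -- The conjugates become opaque letters, so that each value of `ω` is an atom and the identity is
  -- linear over `ℤ` in the additive notation.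
  obtain ⟨g', hg'⟩ : ∃ g', g' = x⁻¹ * g * x := ⟨_, rfl⟩
  obtain ⟨h', hh'⟩ : ∃ h', h' = x⁻¹ * h * x := ⟨_, rfl⟩
  obtain ⟨g'', hg''⟩ : ∃ g'', g'' = y⁻¹ * g' * y := ⟨_, rfl⟩
  obtain ⟨h'', hh''⟩ : ∃ h'', h'' = y⁻¹ * h' * y := ⟨_, rfl⟩
  have eg : x * g' = g * x := by rw [hg', mul_conj_inv_mul]
  have eh : x * h' = h * x := by rw [hh', mul_conj_inv_mul]
  have eg' : y * g'' = g' * y := by rw [hg'', mul_conj_inv_mul]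
  have eh' : y * h'' = h' * y := by rw [hh'', mul_conj_inv_mul]
  have egh : x * (g' * h') = (g * h) * x := by
    rw [← mul_assoc, eg, mul_assoc, eh, mul_assoc]
  have egh' : y * (g'' * h'') = (g' * h') * y := by
    rw [← mul_assoc, eg', mul_assoc, eh', mul_assoc]
  have egg : x * y * g'' = g * (x * y) := by rw [mul_assoc, eg', ← mul_assoc, eg, mul_assoc]
  have ehh : x * y * h'' = h * (x * y) := by rw [mul_assoc, eh', ← mul_assoc, eh, mul_assoc]
  rw [← hg', ← hh', slantTheta_eq_of_conj eg eg', slantTheta_eq_of_conj eh eh',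
    slantTheta_eq_of_conj egh egh', slantGamma_eq_of_conj eg eh, slantGamma_eq_of_conj eg' eh',
    slantGamma_eq_of_conj egg ehh]
  apply ofMul.injective
  simp only [ofMul_mul, ofMul_div]
  -- One relation for each of the six shuffles of `(g, h)` with `(x, y)`, where `g` and `h` are
  -- conjugated when they pass to the right of `x` or `y`. The coefficient below is the sign of the
  -- shuffle.
  have c₁ := hω.ofMul_eq g h x y rfl rfl rfl
  have c₂ := hω.ofMul_eq g x h' y rfl eh rfl
  have c₃ := hω.ofMul_eq x g' h' y eg rfl rfl
  have c₄ := hω.ofMul_eq g x y h'' rfl rfl eh'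
  have c₅ := hω.ofMul_eq x g' y h'' eg rfl eh'
  have c₆ := hω.ofMul_eq x y g'' h'' rfl eg' rfl
  linear_combination (norm := module) c₁ - c₂ + c₃ + c₄ - c₅ + c₆

-- Alternating sum of the four cocycle relations in which `x` is inserted at each place of the word
-- `g, h, k`, conjugated by the letters to its left. So `θ` is a 2-cocycle of the conjugation
-- groupoid.
open Additive in
theorem slantTheta_cocycle (hω : IsThreeCocycle ω) (x g h k : G) :
    slantTheta ω x g h * slantTheta ω x (g * h) k =
      slantTheta ω x g (h * k) * slantTheta ω (g⁻¹ * x * g) h k := by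
  obtain ⟨x', hx'⟩ : ∃ x', x' = g⁻¹ * x * g := ⟨_, rfl⟩
  obtain ⟨x'', hx''⟩ : ∃ x'', x'' = h⁻¹ * x' * h := ⟨_, rfl⟩
  obtain ⟨x₃, hx₃⟩ : ∃ x₃, x₃ = k⁻¹ * x'' * k := ⟨_, rfl⟩
  have e₁ : g * x' = x * g := by rw [hx', mul_conj_inv_mul]
  have e₂ : h * x'' = x' * h := by rw [hx'', mul_conj_inv_mul]
  have e₃ : k * x₃ = x'' * k := by rw [hx₃, mul_conj_inv_mul]
  have e₁₂ : g * h * x'' = x * (g * h) := by rw [mul_assoc, e₂, ← mul_assoc, e₁, mul_assoc]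
  have e₂₃ : h * k * x₃ = x' * (h * k) := by rw [mul_assoc, e₃, ← mul_assoc, e₂, mul_assoc]
  rw [← hx', slantTheta_eq_of_conj e₁ e₂, slantTheta_eq_of_conj e₁₂ e₃,
    slantTheta_eq_of_conj e₁ e₂₃, slantTheta_eq_of_conj e₂ e₃]
  apply ofMul.injective
  simp only [ofMul_mul, ofMul_div]
  have c₁ := hω.ofMul_eq x g h k rfl rfl rfl
  have c₂ := hω.ofMul_eq g x' h k e₁ rfl rfl
  have c₃ := hω.ofMul_eq g h x'' k rfl e₂ rfl
  have c₄ := hω.ofMul_eq g h k x₃ rfl rfl e₃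
  linear_combination (norm := module) c₁ - c₂ + c₃ - c₄

/-- Since `ω` is not normalised this need not be `1`, but it depends only on the conjugate of `x` at
the start of the edge. This is what lets the two loop edges leaving the first vertex cancel. -/
theorem slantTheta_one_right (hω : IsThreeCocycle ω) (x g : G) :
    slantTheta ω x g 1 = slantTheta ω (g⁻¹ * x * g) 1 1 := by
  simpa using slantTheta_cocycle hω x g 1 1

end SlantProducts

/-! ### Prisms over triangles: lifting once and lifting twice -/

section Prisms

variable {G : Type*} [Group G] {ω : G → G → G → Circle}

/-- The cocycles of the prism over a triangle with edge variables `a = ĝ₃₂`, `b = ĝ₂₁` and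
`a'`, `b'` on the upper surface, in which the vertex `i` is lifted by `Xᵢ` if `pᵢ` holds. -/
noncomputable def prismPhase (ω : G → G → G → Circle) (p₁ p₂ p₃ : Prop) [Decidable p₁] [Decidable p₂]
    [Decidable p₃] (X₁ X₂ X₃ a b a' b' : G) : Circle :=
  (if p₃ then ω X₃ a b else 1) * (if p₂ then ω a' X₂ b else 1)⁻¹ *
    (if p₁ then ω a' b' X₁ else 1)

/-- The cocycles above an edge `j → i` with edge variables `a` and `a'` that is coned off to a
vertex with group element `1`. -/
noncomputable def conePhase (ω : G → G → G → Circle) (pi pj : Prop) [Decidable pi] [Decidable pj]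
    (Xi Xj gj a a' : G) : Circle :=
  (if pj then ω a' Xj gj else 1) / (if pi then ω Xi a gj else 1)

/-- The cocycles that relate the lift of an edge `j → i` by `Y` and then by `X` to that by
`X * Y`. -/
noncomputable def stackPhase (ω : G → G → G → Circle) (pi pj : Prop) [Decidable pi] [Decidable pj]
    (Xi Xj Yi Yj a a' a'' : G) : Circle :=
  (if pi ∧ pj then ω Xi a' Yj else 1) /
    ((if pi then ω Xi Yi a else 1) * (if pj then ω a'' Xj Yj else 1))

section

variable {p₁ p₂ p₃ : Prop} [Decidable p₁] [Decidable p₂] [Decidable p₃] {X₁ X₂ X₃ : G}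

theorem prismPhase_eq_slantTheta {a b : G} (h₁ : p₁) (h₂ : p₂) (h₃ : p₃)
    (ha : a * X₂ = X₃ * a) (hb : b * X₁ = X₂ * b) :
    prismPhase ω p₁ p₂ p₃ X₁ X₂ X₃ a b a b = slantTheta ω X₃ a b := by
  rw [slantTheta_eq_of_conj ha hb]
  simp only [prismPhase, if_pos h₁, if_pos h₂, if_pos h₃, div_eq_mul_inv]
  rw [mul_right_comm]

-- Lifts the base of the cone one vertex at a time, in the order 3, 2, 1. Each lift is one cocycle
-- relation, which yields one tetrahedron of the prism and two faces of the cone.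
open Additive in
theorem cocycle_lift_eq_prismPhase_mul (hω : IsThreeCocycle ω) (h₁ : ¬ p₁ → X₁ = 1)
    (h₂ : ¬ p₂ → X₂ = 1) (h₃ : ¬ p₃ → X₃ = 1) {a b a' b' ab ab' g₁ g₂ : G}
    (ha : a' * X₂ = X₃ * a) (hb : b' * X₁ = X₂ * b) (hab : a * b = ab) (hab' : a' * b' = ab')
    (hg : b * g₁ = g₂) :
    ω a' b' (X₁ * g₁) = ω a b g₁ * (prismPhase ω p₁ p₂ p₃ X₁ X₂ X₃ a b a' b' *
      (conePhase ω p₃ p₂ X₃ X₂ g₂ a a' * conePhase ω p₂ p₁ X₂ X₁ g₁ b b' /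
        conePhase ω p₃ p₁ X₃ X₁ g₁ ab ab')) := by
  -- An unlifted vertex contributes no tetrahedron at all. For it `X₃ = 1` makes both sides equal
  -- without invoking normalisation of `ω`.
  have step₃ : ω (X₃ * a) b g₁ = ω a b g₁ * ((if p₃ then ω X₃ a b else 1) *
      ((if p₃ then ω X₃ ab g₁ else 1) / (if p₃ then ω X₃ a g₂ else 1))) := by
    by_cases h : p₃
    · simp only [if_pos h]
      apply ofMul.injective
      simp only [ofMul_mul, ofMul_div]
      have c := hω.ofMul_eq X₃ a b g₁ rfl hab hg
      linear_combination (norm := module) -c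
    · simp [h, h₃ h]
  have step₂ : ω a' (X₂ * b) g₁ = ω (X₃ * a) b g₁ * ((if p₂ then ω a' X₂ b else 1)⁻¹ *
      ((if p₂ then ω a' X₂ g₂ else 1) / (if p₂ then ω X₂ b g₁ else 1))) := by
    by_cases h : p₂
    · simp only [if_pos h]
      apply ofMul.injective
      simp only [ofMul_mul, ofMul_div, ofMul_inv]
      have c := hω.ofMul_eq a' X₂ b g₁ ha rfl hg
      linear_combination (norm := module) c
    · have : a' = X₃ * a := by rw [← ha, h₂ h, mul_one]
      simp [h, h₂ h, this]
  have step₁ : ω a' b' (X₁ * g₁) = ω a' (X₂ * b) g₁ * ((if p₁ then ω a' b' X₁ else 1) *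
      ((if p₁ then ω b' X₁ g₁ else 1) / (if p₁ then ω ab' X₁ g₁ else 1))) := by
    by_cases h : p₁
    · simp only [if_pos h]
      apply ofMul.injective
      simp only [ofMul_mul, ofMul_div]
      have c := hω.ofMul_eq a' b' X₁ g₁ hab' hb rfl
      linear_combination (norm := module) -c
    · have : b' = X₂ * b := by rw [← hb, h₁ h, mul_one]
      simp [h, h₁ h, this]
  rw [step₁, step₂, step₃, prismPhase, conePhase, conePhase, conePhase]
  apply ofMul.injective
  simp only [ofMul_mul, ofMul_div, ofMul_inv]
  module

-- The two stacked prisms and the single one bound the 4-simplices indexed by shuffles of `(X, Y)`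
-- with `(a, b)`. The walls over the three sides of the triangle form the coboundary of
-- `stackPhase`.
open Additive in
theorem prismPhase_mul_prismPhase (hω : IsThreeCocycle ω) {Y₁ Y₂ Y₃ : G}
    (hX₁ : ¬ p₁ → X₁ = 1) (hX₂ : ¬ p₂ → X₂ = 1) (hX₃ : ¬ p₃ → X₃ = 1)
    (hY₁ : ¬ p₁ → Y₁ = 1) (hY₂ : ¬ p₂ → Y₂ = 1) (hY₃ : ¬ p₃ → Y₃ = 1)
    {a b a' b' a'' b'' ab ab' ab'' : G}
    (ha : a' * Y₂ = Y₃ * a) (hb : b' * Y₁ = Y₂ * b)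
    (ha' : a'' * X₂ = X₃ * a') (hb' : b'' * X₁ = X₂ * b')
    (hab : a * b = ab) (hab' : a' * b' = ab') (hab'' : a'' * b'' = ab'') :
    prismPhase ω p₁ p₂ p₃ X₁ X₂ X₃ a' b' a'' b'' * prismPhase ω p₁ p₂ p₃ Y₁ Y₂ Y₃ a b a' b' =
      prismPhase ω p₁ p₂ p₃ (X₁ * Y₁) (X₂ * Y₂) (X₃ * Y₃) a b a'' b'' *
        (stackPhase ω p₃ p₂ X₃ X₂ Y₃ Y₂ a a' a'' * stackPhase ω p₂ p₁ X₂ X₁ Y₂ Y₁ b b' b'' /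
          stackPhase ω p₃ p₁ X₃ X₁ Y₃ Y₁ ab ab' ab'') := by
  -- The first index is the vertex at which `X` stands, the second that of `Y`. A relation is used
  -- exactly when both vertices are lifted, with the sign of its shuffle.
  have c₃₃ := hω.ofMul_eq X₃ Y₃ a b rfl rfl hab
  have c₃₂ := hω.ofMul_eq X₃ a' Y₂ b rfl ha rfl
  have c₃₁ := hω.ofMul_eq X₃ a' b' Y₁ rfl hab' hb
  have c₂₂ := hω.ofMul_eq a'' X₂ Y₂ b ha' rfl rfl
  have c₂₁ := hω.ofMul_eq a'' X₂ b' Y₁ ha' rfl hb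
  have c₁₁ := hω.ofMul_eq a'' b'' X₁ Y₁ hab'' hb' rfl
  apply ofMul.injective
  simp only [prismPhase, stackPhase, ofMul_mul, ofMul_div, ofMul_inv]
  by_cases h₃ : p₃ <;> by_cases h₂ : p₂ <;> by_cases h₁ : p₁
  all_goals
    simp only [h₁, h₂, h₃, not_true_eq_false, not_false_eq_true, false_imp_iff,
      true_imp_iff] at hX₁ hX₂ hX₃ hY₁ hY₂ hY₃
    simp only [h₁, h₂, h₃, if_true, if_false, and_true, and_false, ofMul_one]
  · linear_combination (norm := module) c₃₃ - c₃₂ + c₃₁ + c₂₂ - c₂₁ + c₁₁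
  · subst hX₁ hY₁
    rw [mul_one] at hb hb'
    subst hb hb'
    linear_combination (norm := module) c₃₃ - c₃₂ + c₂₂
  · subst hX₂ hY₂
    rw [mul_one] at ha ha'
    rw [one_mul] at hb hb'
    subst ha ha' hb hb'
    simp only [one_mul] at c₃₁ c₁₁
    linear_combination (norm := module) c₃₃ + c₃₁ + c₁₁
  · subst hX₁ hY₁ hX₂ hY₂
    rw [mul_one] at ha ha' hb hb'
    rw [one_mul] at hb hb'
    subst ha ha' hb hb'
    linear_combination (norm := module) c₃₃
  · subst hX₃ hY₃
    rw [one_mul] at ha ha'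
    subst ha ha'
    simp only [one_mul] at c₂₂ c₂₁
    linear_combination (norm := module) c₂₂ - c₂₁ + c₁₁
  · subst hX₃ hY₃ hX₁ hY₁
    rw [one_mul] at ha ha'
    rw [mul_one] at hb hb'
    subst ha ha' hb hb'
    rw [one_mul] at c₂₂
    linear_combination (norm := module) c₂₂
  · subst hX₃ hY₃ hX₂ hY₂
    rw [one_mul] at ha ha' hb hb'
    rw [mul_one] at ha ha'
    subst ha ha' hb hb'
    rw [one_mul] at c₁₁
    linear_combination (norm := module) c₁₁
  · module

end

end Prisms

/-! ### Discrete Stokes theorem and the boundary of the region -/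

theorem zpow_finset_sum {A ι : Type*} [CommGroup A] (a : A) (s : Finset ι) (f : ι → ℤ) :
    a ^ (∑ i ∈ s, f i) = ∏ i ∈ s, a ^ f i := by
  classical
  induction s using Finset.induction_on with
  | empty => simp
  | insert i s hi ih => rw [Finset.sum_insert hi, Finset.prod_insert hi, zpow_add, ih]

namespace BranchedTriangulation

variable {V E F : Type*} (T : BranchedTriangulation V E F)

/-- The coefficient of the edge `e` in the boundary of the chain of the triangles satisfying `P`. -/
def chainCoeff [Fintype F] [DecidableEq E] (P : F → Prop) [DecidablePred P] (e : E) : ℤ :=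
  ∑ Δ : F, ∑ i : Fin 3,
    if P Δ ∧ T.face Δ i = e then (T.sign Δ : ℤ) * (-1) ^ (i : ℕ) else 0

/-- The multiplicative coboundary of a cochain on the edges. -/
def coboundary {A : Type*} [CommGroup A] (β : E → A) (Δ : F) : A :=
  β (T.face Δ 0) * β (T.face Δ 2) / β (T.face Δ 1)

/-- Summation by parts: exchange the products over triangles and edges, and collect the exponent of
each edge. -/
theorem prod_coboundary [Fintype F] [Fintype E] [DecidableEq E] {A : Type*} [CommGroup A]
    (P : F → Prop) [DecidablePred P] (β : E → A) :
    (∏ Δ : F, if P Δ then T.coboundary β Δ ^ (T.sign Δ : ℤ) else 1) =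
      ∏ e : E, β e ^ T.chainCoeff P e := by
  simp only [chainCoeff, zpow_finset_sum]
  rw [Finset.prod_comm]
  refine Finset.prod_congr rfl fun Δ _ => ?_
  have key : ∀ i : Fin 3, (∏ e : E, β e ^ (if P Δ ∧ T.face Δ i = e then
      (T.sign Δ : ℤ) * (-1) ^ (i : ℕ) else 0)) =
      if P Δ then (β (T.face Δ i)) ^ ((T.sign Δ : ℤ) * (-1) ^ (i : ℕ)) else 1 := fun i => by
    rw [Finset.prod_eq_single (T.face Δ i)]
    · by_cases h : P Δ <;> simp [h]
    · intro e _ he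
      rw [if_neg fun h => he h.2.symm, zpow_zero]
    · simp
  rw [Finset.prod_comm, Finset.prod_congr rfl fun i _ => key i]
  by_cases h : P Δ
  · simp only [if_pos h, Fin.prod_univ_three, coboundary]
    simp only [div_zpow, mul_zpow, Fin.val_zero, Fin.val_one, Fin.val_two, pow_zero,
      pow_one, mul_one, mul_neg, zpow_neg, neg_one_sq]
    rw [div_eq_mul_inv, mul_right_comm]
  · simp [h]

theorem face_endpoints (Δ : F) (i : Fin 3) :
    (T.src (T.face Δ i) = T.v1 Δ ∧ T.tgt (T.face Δ i) = T.v2 Δ) ∨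
    (T.src (T.face Δ i) = T.v1 Δ ∧ T.tgt (T.face Δ i) = T.v3 Δ) ∨
    (T.src (T.face Δ i) = T.v2 Δ ∧ T.tgt (T.face Δ i) = T.v3 Δ) := by
  fin_cases i
  · exact Or.inr (Or.inr ⟨T.src_face_zero Δ, rfl⟩)
  · exact Or.inr (Or.inl ⟨T.src_face_one Δ, (T.tgt_face_zero Δ).symm⟩)
  · exact Or.inl ⟨rfl, rfl⟩

/-- The triangle has a vertex in the region. -/
def Meets (R : Finset V) (Δ : F) : Prop := T.v1 Δ ∈ R ∨ T.v2 Δ ∈ R ∨ T.v3 Δ ∈ R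

instance [DecidableEq V] (R : Finset V) (Δ : F) : Decidable (T.Meets R Δ) := by
  unfold Meets; infer_instance

theorem meets_face {R : Finset V} {Δ : F} {i : Fin 3}
    (h : T.src (T.face Δ i) ∈ R ∨ T.tgt (T.face Δ i) ∈ R) : T.Meets R Δ := by
  rcases T.face_endpoints Δ i with ⟨h₁, h₂⟩ | ⟨h₁, h₂⟩ | ⟨h₁, h₂⟩ <;>
    rw [h₁, h₂] at h <;> unfold Meets <;> tauto

theorem InRegion.face_mem {R : Finset V} {Δ : F} (h : T.InRegion R Δ) (i : Fin 3) :
    T.src (T.face Δ i) ∈ R ∧ T.tgt (T.face Δ i) ∈ R := by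
  obtain ⟨h1, h2, h3⟩ := h
  rcases T.face_endpoints Δ i with ⟨h₁, h₂⟩ | ⟨h₁, h₂⟩ | ⟨h₁, h₂⟩ <;>
    rw [h₁, h₂] <;> tauto

theorem crosses_iff {R : Finset V} {Δ : F} :
    T.Crosses R Δ ↔ T.Meets R Δ ∧ ¬ T.InRegion R Δ := Iff.rfl

theorem crosses_of_edgeCrosses {R : Finset V} {Δ : F} {i : Fin 3}
    (h : T.EdgeCrosses R (T.face Δ i)) : T.Crosses R Δ := by
  refine ⟨T.meets_face (i := i) (h.imp And.left And.left), fun hR => ?_⟩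
  obtain ⟨h₁, h₂⟩ := InRegion.face_mem T hR i
  exact h.elim (fun h => h.2 h₂) fun h => h.2 h₁

theorem InRegion.meets {R : Finset V} {Δ : F} (h : T.InRegion R Δ) : T.Meets R Δ := Or.inl h.1

section Chains

variable [Fintype F] [DecidableEq E]

theorem chainCoeff_congr {P Q : F → Prop} [DecidablePred P] [DecidablePred Q] {e : E}
    (h : ∀ Δ i, T.face Δ i = e → (P Δ ↔ Q Δ)) : T.chainCoeff P e = T.chainCoeff Q e := by
  refine Finset.sum_congr rfl fun Δ _ => Finset.sum_congr rfl fun i _ => ?_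
  by_cases he : T.face Δ i = e
  · simp only [h Δ i he]
  · simp [he]

/-- Any two sides at an edge have opposite nonzero coefficients, so there cannot be three; the two
that exist cancel. -/
theorem chainCoeff_eq_zero_of_sides {e : E}
    (h : ∃ Δ i Δ' j, (Δ, i) ≠ (Δ', j) ∧ T.face Δ i = e ∧ T.face Δ' j = e) :
    T.chainCoeff (fun _ => True) e = 0 := by
  classical
  obtain ⟨Δ, i, Δ', j, hne, hi, hj⟩ := h
  set c : F × Fin 3 → ℤ := fun p => (T.sign p.1 : ℤ) * (-1) ^ (p.2 : ℕ) with hc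
  have hc0 : ∀ p, c p ≠ 0 := fun p => by simp [hc]
  have hop : ∀ p q : F × Fin 3, T.face p.1 p.2 = e → T.face q.1 q.2 = e → p ≠ q → c p = -c q :=
    fun p q hp hq hpq => T.opposite p.1 p.2 q.1 q.2 (hp.trans hq.symm) hpq
  have hset : (Finset.univ.filter fun p : F × Fin 3 => T.face p.1 p.2 = e) =
      {(Δ, i), (Δ', j)} := by
    ext p
    simp only [Finset.mem_filter, Finset.mem_univ, true_and, Finset.mem_insert,
      Finset.mem_singleton]
    refine ⟨fun hp => ?_, ?_⟩
    · by_contra! hne'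
      have h1 := hop p (Δ, i) hp hi hne'.1
      have h2 := hop p (Δ', j) hp hj hne'.2
      have h3 := hop (Δ, i) (Δ', j) hi hj hne
      have := hc0 (Δ', j)
      omega
    · rintro (rfl | rfl) <;> assumption
  have : T.chainCoeff (fun _ => True) e = ∑ p : F × Fin 3, if T.face p.1 p.2 = e then c p else 0 := by
    rw [Fintype.sum_prod_type]
    simp [chainCoeff, hc]
  rw [this, ← Finset.sum_filter, hset, Finset.sum_pair hne, hop (Δ, i) (Δ', j) hi hj hne]
  simp

theorem boundaryCoeff_eq_chainCoeff [DecidableEq V] (R : Finset V) (e : E) :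
    T.boundaryCoeff R e = T.chainCoeff (T.InRegion R) e := rfl

/-- A triangle with a side meeting the region either lies in the region or is crossed. -/
theorem chainCoeff_crosses_add [DecidableEq V] (R : Finset V) {e : E}
    (he : T.src e ∈ R ∨ T.tgt e ∈ R) :
    T.chainCoeff (T.Crosses R) e + T.boundaryCoeff R e = T.chainCoeff (fun _ => True) e := by
  rw [T.chainCoeff_congr (P := fun _ => True) (Q := T.Meets R) fun Δ i h =>
    ⟨fun _ => T.meets_face (i := i) (h ▸ he), fun _ => trivial⟩]
  simp only [boundaryCoeff_eq_chainCoeff, chainCoeff, ← Finset.sum_add_distrib]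
  refine Finset.sum_congr rfl fun Δ _ => Finset.sum_congr rfl fun i _ => ?_
  have := T.crosses_iff (R := R) (Δ := Δ)
  have := InRegion.meets T (R := R) (Δ := Δ)
  by_cases h1 : T.InRegion R Δ <;> by_cases h2 : T.Meets R Δ <;> simp_all

end Chains

namespace BoundaryLoop

variable {T} [Fintype F] [DecidableEq V] [DecidableEq E] {R : Finset V} (b : T.BoundaryLoop R)

theorem chainCoeff_true_eq_zero (b : T.BoundaryLoop R) {e : E} (he : T.src e ∈ R ∨ T.tgt e ∈ R) :
    T.chainCoeff (fun _ => True) e = 0 :=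
  T.chainCoeff_eq_zero_of_sides (b.interior e he)

theorem chainCoeff_crosses (b : T.BoundaryLoop R) {e : E} (he : T.src e ∈ R ∨ T.tgt e ∈ R) :
    T.chainCoeff (T.Crosses R) e = -T.boundaryCoeff R e :=
  eq_neg_of_add_eq_zero_left
    ((T.chainCoeff_crosses_add R he).trans (b.chainCoeff_true_eq_zero he))

theorem prod_zpow_boundaryCoeff [Fintype E] {A : Type*} [CommGroup A] (β : E → A) :
    ∏ e, β e ^ T.boundaryCoeff R e = (∏ k, β (b.edge k)) / β b.closing := by
  simp only [b.boundary_eq, zpow_sub, div_eq_mul_inv, Finset.prod_mul_distrib,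
    Finset.prod_inv_distrib]
  congr 1
  · simp only [zpow_finset_sum]
    rw [Finset.prod_comm]
    refine Finset.prod_congr rfl fun k _ => ?_
    rw [Finset.prod_eq_single (b.edge k)] <;> simp +contextual [eq_comm]
  · rw [inv_inj, Finset.prod_eq_single b.closing] <;> simp +contextual [eq_comm]

theorem prod_coboundary_eq_one (b : T.BoundaryLoop R) [Fintype E] {A : Type*} [CommGroup A] {β : E → A}
    (hβ : ∀ e, T.src e ∉ R → T.tgt e ∉ R → β e = 1) :
    ∏ Δ : F, T.coboundary β Δ ^ (T.sign Δ : ℤ) = 1 := by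
  have := T.prod_coboundary (fun _ => True) β
  simp only [if_true] at this
  rw [this]
  refine Finset.prod_eq_one fun e _ => ?_
  by_cases h : T.src e ∈ R ∨ T.tgt e ∈ R
  · rw [b.chainCoeff_true_eq_zero h, zpow_zero]
  · rw [hβ e (fun h' => h (Or.inl h')) fun h' => h (Or.inr h'), one_zpow]

theorem prod_coboundary_inRegion [Fintype E] {A : Type*} [CommGroup A] (β : E → A) :
    (∏ Δ : F, if T.InRegion R Δ then T.coboundary β Δ ^ (T.sign Δ : ℤ) else 1) =
      (∏ k, β (b.edge k)) / β b.closing := by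
  rw [T.prod_coboundary, ← b.prod_zpow_boundaryCoeff]
  rfl

/-- The crossed triangles form a collar whose boundary, on edges meeting the region, is minus the
loop. The outer boundary is invisible to `β`. -/
theorem prod_coboundary_crosses [Fintype E] {A : Type*} [CommGroup A] {β : E → A}
    (hβ : ∀ e, T.src e ∉ R → T.tgt e ∉ R → β e = 1) :
    (∏ Δ : F, if T.Crosses R Δ then T.coboundary β Δ ^ (T.sign Δ : ℤ) else 1) =
      β b.closing / ∏ k, β (b.edge k) := by
  rw [T.prod_coboundary, ← inv_div, ← b.prod_zpow_boundaryCoeff, ← Finset.prod_inv_distrib]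
  refine Finset.prod_congr rfl fun e _ => ?_
  by_cases h : T.src e ∈ R ∨ T.tgt e ∈ R
  · rw [b.chainCoeff_crosses h, zpow_neg]
  · rw [hβ e (fun h' => h (Or.inl h')) fun h' => h (Or.inr h')]
    simp

/-- An edge between vertices of the region that is a side of a crossed triangle is on the loop. -/
theorem eq_edge_or_closing {Δ : F} {i : Fin 3} (hΔ : T.Crosses R Δ)
    (hs : T.src (T.face Δ i) ∈ R) (ht : T.tgt (T.face Δ i) ∈ R) :
    (∃ k, b.edge k = T.face Δ i) ∨ b.closing = T.face Δ i := by
  by_contra! hne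
  obtain ⟨Δ', j, hΔ', hj⟩ := b.full _ hs ht
  have h0 : T.boundaryCoeff R (T.face Δ i) = 0 := by
    rw [b.boundary_eq, if_neg hne.2, Finset.sum_eq_zero fun k _ => if_neg (hne.1 k), sub_zero]
  have hne' : ∀ p : F × Fin 3, T.InRegion R p.1 → p ≠ (Δ, i) := by
    rintro p hp rfl
    exact hΔ.2 hp
  -- Two sides in the region and the one in the crossed triangle would be pairwise opposite and
  -- nonzero, which is impossible. So one side in the region remains and the boundary coefficient is
  -- `±1`, contradicting that the edge is off the loop.
  have hu : ∀ p : F × Fin 3, T.InRegion R p.1 → T.face p.1 p.2 = T.face Δ i → p = (Δ', j) := by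
    intro p hp hpe
    by_contra hpj
    have h1 := T.opposite p.1 p.2 Δ i hpe (hne' p hp)
    have h2 := T.opposite Δ' j Δ i hj (hne' (Δ', j) hΔ')
    have h3 := T.opposite p.1 p.2 Δ' j (hpe.trans hj.symm) hpj
    have : (T.sign Δ : ℤ) * (-1) ^ (i : ℕ) ≠ 0 := by simp
    omega
  have h1 : T.boundaryCoeff R (T.face Δ i) = (T.sign Δ' : ℤ) * (-1) ^ (j : ℕ) := by
    rw [boundaryCoeff, ← Fintype.sum_prod_type', Finset.sum_eq_single (Δ', j)]
    · simp [hΔ', hj]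
    · intro p _ hp
      exact if_neg fun h => hp (hu p h.1 h.2)
    · simp
  have : (T.sign Δ' : ℤ) * (-1) ^ (j : ℕ) ≠ 0 := by simp
  exact this (h1.symm.trans h0)

end BoundaryLoop

end BranchedTriangulation

theorem Fin.prod_univ_div_telescope {A : Type*} [CommGroup A] {m : ℕ} (Γ : Fin (m + 1) → A) :
    ∏ k : Fin m, Γ k.succ / Γ k.castSucc = Γ (Fin.last m) / Γ 0 := by
  induction m with
  | zero => simp
  | succ m ih =>
    rw [Fin.prod_univ_castSucc, ← Fin.succ_last]
    have := ih fun k => Γ k.castSucc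
    simp only [Fin.succ_castSucc, Fin.castSucc_zero] at this ⊢
    rw [this, mul_comm, div_mul_div_cancel]

/-! ### Transport along the loop and the shift of crossed edges -/

namespace BranchedTriangulation

variable {V E F G : Type*} [DecidableEq V] [DecidableEq E] [Fintype F] [Group G]
  {T : BranchedTriangulation V E F}

namespace BoundaryLoop

variable {R : Finset V} (b : T.BoundaryLoop R)

theorem path_zero (c : Config V E G) : b.path c 0 = 1 := rfl

theorem path_succ (c : Config V E G) (k : Fin b.m) :
    b.path c k.succ = c.2 (b.edge k) * b.path c k.castSucc := rfl

theorem path_congr {c d : Config V E G} (h : ∀ k, c.2 (b.edge k) = d.2 (b.edge k)) :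
    b.path c = b.path d := by
  funext k
  induction k using Fin.induction with
  | zero => rfl
  | succ k ih => rw [path_succ, path_succ, ih, h]

theorem transport_vtx (x : G) (c : Config V E G) (k : Fin (b.m + 1)) :
    b.transport x c (b.vtx k) = b.transportAt x c k :=
  b.vtx_injective.extend_apply _ _ _

theorem transport_congr (x : G) {c d : Config V E G}
    (h : ∀ k, c.2 (b.edge k) = d.2 (b.edge k)) : b.transport x c = b.transport x d := by
  have : b.transportAt x c = b.transportAt x d := by
    funext k
    simp only [transportAt, b.path_congr h]
  rw [transport, transport, this]

theorem transport_mul (x y : G) (c : Config V E G) (v : V) :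
    b.transport (x * y) c v = b.transport x c v * b.transport y c v := by
  by_cases h : ∃ k, b.vtx k = v
  · obtain ⟨k, rfl⟩ := h
    simp only [transport_vtx, transportAt]
    group
  · simp [transport, Function.extend_apply' _ _ _ h]

theorem lift_mul (x y : G) (c : Config V E G) (v : V) :
    b.lift (x * y) c v = b.lift x c v * b.lift y c v := by
  rw [lift, lift, lift, transport_mul]
  group

theorem transport_edge (x : G) (c : Config V E G) (k : Fin b.m) :
    b.transport x c (T.tgt (b.edge k)) * c.2 (b.edge k) =
      c.2 (b.edge k) * b.transport x c (T.src (b.edge k)) := by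
  rw [b.tgt_edge, b.src_edge, transport_vtx, transport_vtx, transportAt, transportAt, path_succ]
  group

theorem transport_ref (x : G) (c : Config V E G) : b.transport x c b.ref = x := by
  rw [ref, transport_vtx, transportAt]
  group

/-- Transport is built along the path and ignores the closing edge. Going around the loop gives back
`x` exactly when `x` commutes with the holonomy. -/
theorem transport_closing {x : G} {c : Config V E G} (h : Commute x (b.holonomy c)) :
    b.transport x c (T.tgt b.closing) * c.2 b.closing =
      c.2 b.closing * b.transport x c (T.src b.closing) := by
  have := h.eq
  rw [holonomy] at this
  rw [b.tgt_closing, b.src_closing, transport_vtx, transport_vtx, transportAt, transportAt,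
    path_zero]
  have h2 : b.path c (Fin.last b.m) * (c.2 b.closing)⁻¹ * x * (c.2 b.closing) =
      x * b.path c (Fin.last b.m) := by rw [← this]; group
  have h3 : (c.2 b.closing)⁻¹ * x * c.2 b.closing = (b.path c (Fin.last b.m))⁻¹ * x *
      b.path c (Fin.last b.m) := by
    calc (c.2 b.closing)⁻¹ * x * c.2 b.closing = (b.path c (Fin.last b.m))⁻¹ *
          (b.path c (Fin.last b.m) * (c.2 b.closing)⁻¹ * x * c.2 b.closing) := by group
      _ = _ := by rw [h2]; group
  simp only [mul_inv_cancel, one_mul, inv_one, mul_one, inv_inv]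
  rw [← h3]
  group

section Shift

variable (x y : G) (c : Config V E G)

theorem shift_fst : (b.shift x c).1 = c.1 := rfl

theorem shift_snd_of_mem {e : E} (h : T.src e ∈ R ↔ T.tgt e ∈ R) :
    (b.shift x c).2 e = c.2 e := by
  simp only [shift]
  rw [if_neg fun h' => h'.2 (h.2 h'.1), if_neg fun h' => h'.2 (h.1 h'.1)]

theorem edge_mem (k : Fin b.m) : T.src (b.edge k) ∈ R ∧ T.tgt (b.edge k) ∈ R := by
  rw [b.src_edge, b.tgt_edge]
  exact ⟨b.vtx_mem _, b.vtx_mem _⟩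

theorem closing_mem : T.src b.closing ∈ R ∧ T.tgt b.closing ∈ R := by
  rw [b.src_closing, b.tgt_closing]
  exact ⟨b.vtx_mem _, b.vtx_mem _⟩

/-- Loop edges have both ends in the region and are not crossed. Hence path, transport and holonomy
are unaffected by shifts, and shifts compose as in `G`. -/
theorem shift_snd_edge (k : Fin b.m) : (b.shift x c).2 (b.edge k) = c.2 (b.edge k) :=
  b.shift_snd_of_mem x c (iff_of_true (b.edge_mem k).1 (b.edge_mem k).2)

theorem shift_snd_closing : (b.shift x c).2 b.closing = c.2 b.closing :=
  b.shift_snd_of_mem x c (iff_of_true b.closing_mem.1 b.closing_mem.2)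

theorem path_shift : b.path (b.shift x c) = b.path c := b.path_congr (b.shift_snd_edge x c)

theorem transport_shift : b.transport x (b.shift y c) = b.transport x c :=
  b.transport_congr x (b.shift_snd_edge y c)

theorem lift_shift (v : V) : b.lift x (b.shift y c) v = b.lift x c v := by
  rw [lift, lift, transport_shift, shift_fst]

theorem holonomy_shift : b.holonomy (b.shift x c) = b.holonomy c := by
  rw [holonomy, holonomy, path_shift, shift_snd_closing]

theorem dressedHolonomy_shift : b.dressedHolonomy (b.shift x c) = b.dressedHolonomy c := by
  rw [dressedHolonomy, dressedHolonomy, holonomy_shift, shift_fst]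

theorem edgeVar_shift_edge (k : Fin b.m) :
    T.edgeVar (b.shift x c) (b.edge k) = T.edgeVar c (b.edge k) := by
  rw [edgeVar, edgeVar, shift_fst, shift_snd_edge]

theorem edgeVar_shift_closing : T.edgeVar (b.shift x c) b.closing = T.edgeVar c b.closing := by
  rw [edgeVar, edgeVar, shift_fst, shift_snd_closing]

theorem shift_shift : b.shift x (b.shift y c) = b.shift (x * y) c := by
  refine Prod.ext rfl (funext fun e => ?_)
  have ht := b.transport_shift x y c
  rw [shift]
  simp only [ht]
  simp only [shift, transport_mul]
  split_ifs
  · rw [mul_assoc]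
  · rw [mul_inv_rev, mul_assoc]
  · rfl

/-- The lift of the vertices of the region, extended by `1` to the other vertices. -/
noncomputable def regionLift (v : V) : G := if v ∈ R then b.lift x c v else 1

theorem regionLift_of_notMem {v : V} (h : v ∉ R) : b.regionLift x c v = 1 := if_neg h

theorem regionLift_of_mem {v : V} (h : v ∈ R) : b.regionLift x c v = b.lift x c v := if_pos h

theorem regionLift_mul (v : V) :
    b.regionLift (x * y) c v = b.regionLift x c v * b.regionLift y c v := by
  by_cases h : v ∈ R <;> simp [regionLift, h, lift_mul]

theorem regionLift_shift (v : V) : b.regionLift x (b.shift y c) v = b.regionLift x c v := by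
  rw [regionLift, regionLift, lift_shift]

/-- The square between an edge and its lift is flat. For a crossed edge this is how the shift is
defined; for an edge inside the region it is compatibility of the transport. -/
theorem edgeVar_shift_mul {e : E} (h : T.src e ∈ R → T.tgt e ∈ R →
      b.transport x c (T.tgt e) * c.2 e = c.2 e * b.transport x c (T.src e)) :
    T.edgeVar (b.shift x c) e * b.regionLift x c (T.src e) =
      b.regionLift x c (T.tgt e) * T.edgeVar c e := by
  rw [edgeVar, edgeVar, shift_fst]
  by_cases hs : T.src e ∈ R <;> by_cases ht : T.tgt e ∈ R <;>
    simp only [regionLift, hs, ht, if_true, if_false, shift, lift, not_true_eq_false,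
      not_false_eq_true, and_true, and_false]
  · have := h hs ht
    calc _ = c.1 (T.tgt e) * (c.2 e * b.transport x c (T.src e)) * (c.1 (T.src e))⁻¹ := by group
      _ = _ := by rw [← this]; group
  · group
  · group
  · group

end Shift

/-- A crossed triangle has a vertex outside, so each of its vertices in the region is joined to the
outside. The default value of `transport` off the loop is therefore never seen by `W`. -/
theorem exists_vtx_of_crosses {Δ : F} (h : T.Crosses R Δ) {v : V}
    (hv : v = T.v1 Δ ∨ v = T.v2 Δ ∨ v = T.v3 Δ) (hR : v ∈ R) : ∃ k, b.vtx k = v := by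
  have e0 : T.src (T.face Δ 0) = T.v2 Δ ∧ T.tgt (T.face Δ 0) = T.v3 Δ := ⟨T.src_face_zero Δ, rfl⟩
  have e1 : T.src (T.face Δ 1) = T.v1 Δ ∧ T.tgt (T.face Δ 1) = T.v3 Δ :=
    ⟨T.src_face_one Δ, (T.tgt_face_zero Δ).symm⟩
  have hsrc : ∀ i, T.src (T.face Δ i) ∈ R → T.tgt (T.face Δ i) ∉ R →
      ∃ k, b.vtx k = T.src (T.face Δ i) := fun i hs ht =>
    b.mem_loop _ (Or.inl ⟨hs, ht⟩) _ hs (Or.inl rfl)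
  have htgt : ∀ i, T.tgt (T.face Δ i) ∈ R → T.src (T.face Δ i) ∉ R →
      ∃ k, b.vtx k = T.tgt (T.face Δ i) := fun i ht hs =>
    b.mem_loop _ (Or.inr ⟨ht, hs⟩) _ ht (Or.inr rfl)
  have hs1 := hsrc 1
  have ht1 := htgt 1
  have hs0 := hsrc 0
  have ht0 := htgt 0
  rw [e0.1, e0.2] at hs0 ht0
  rw [e1.1, e1.2] at hs1 ht1
  rcases hv with rfl | rfl | rfl
  · by_cases h3 : T.v3 Δ ∈ R
    · exact hsrc 2 hR fun h2 => h.2 ⟨hR, h2, h3⟩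
    · exact hs1 hR h3
  · by_cases h3 : T.v3 Δ ∈ R
    · exact htgt 2 hR fun h1 => h.2 ⟨h1, hR, h3⟩
    · exact hs0 hR h3
  · by_cases h1 : T.v1 Δ ∈ R
    · exact ht0 hR fun h2 => h.2 ⟨h1, h2, hR⟩
    · exact ht1 hR h1

theorem transport_face {Δ : F} (hΔ : T.Crosses R Δ) (i : Fin 3) {x : G} {c : Config V E G}
    (hx : Commute x (b.holonomy c)) (hs : T.src (T.face Δ i) ∈ R) (ht : T.tgt (T.face Δ i) ∈ R) :
    b.transport x c (T.tgt (T.face Δ i)) * c.2 (T.face Δ i) =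
      c.2 (T.face Δ i) * b.transport x c (T.src (T.face Δ i)) := by
  rcases b.eq_edge_or_closing hΔ hs ht with ⟨k, hk⟩ | hk <;> rw [← hk]
  · exact b.transport_edge x c k
  · exact b.transport_closing hx

theorem edgeVar_shift_face_mul {Δ : F} (hΔ : T.Crosses R Δ) (i : Fin 3) {x : G}
    {c : Config V E G} (hx : Commute x (b.holonomy c)) :
    T.edgeVar (b.shift x c) (T.face Δ i) * b.regionLift x c (T.src (T.face Δ i)) =
      b.regionLift x c (T.tgt (T.face Δ i)) * T.edgeVar c (T.face Δ i) :=
  b.edgeVar_shift_mul x c fun hs ht => b.transport_face hΔ i hx hs ht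

theorem edgeVar_mul_of_flat {V E F G : Type*} [Group G] {T : BranchedTriangulation V E F}
    {R : Finset V} {c : Config V E G} (hc : FlatNearLoop T R c) {Δ : F}
    (hΔ : T.Crosses R Δ) :
    T.edgeVar c (T.face Δ 0) * T.edgeVar c (T.face Δ 2) = T.edgeVar c (T.face Δ 1) := by
  rw [edgeVar, edgeVar, edgeVar, ← hc Δ hΔ, T.src_face_zero, T.tgt_face_zero, T.src_face_one]
  group

/-- Upper edge variables have the form `X_tgt ĝ X_src⁻¹`, and the factors at the middle vertex
cancel along `1 → 2 → 3`. -/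
theorem flatNearLoop_shift {c : Config V E G} (hc : FlatNearLoop T R c) {x : G}
    (hx : Commute x (b.holonomy c)) : FlatNearLoop T R (b.shift x c) := by
  intro Δ hΔ
  have h0 := b.edgeVar_shift_face_mul hΔ 0 hx
  have h1 := b.edgeVar_shift_face_mul hΔ 1 hx
  have h2 := b.edgeVar_shift_face_mul hΔ 2 hx
  rw [← eq_mul_inv_iff_mul_eq] at h0 h1 h2
  have key : T.edgeVar (b.shift x c) (T.face Δ 0) * T.edgeVar (b.shift x c) (T.face Δ 2) =
      T.edgeVar (b.shift x c) (T.face Δ 1) := by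
    rw [h0, h1, h2, ← edgeVar_mul_of_flat hc hΔ, T.src_face_zero, T.tgt_face_zero, T.src_face_one]
    group
  rw [edgeVar, edgeVar, edgeVar, T.src_face_zero, T.tgt_face_zero, T.src_face_one] at key
  have key' := congrArg (fun z => ((b.shift x c).1 (T.tgt (T.face Δ 1)))⁻¹ * z *
    (b.shift x c).1 (T.src (T.face Δ 2))) key
  simpa [mul_assoc] using key'

theorem trianglePhase_eq (ω : G → G → G → Circle) (x : G) (c : Config V E G) (Δ : F) :
    b.trianglePhase ω x c Δ = prismPhase ω (T.v1 Δ ∈ R) (T.v2 Δ ∈ R) (T.v3 Δ ∈ R)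
      (b.regionLift x c (T.v1 Δ)) (b.regionLift x c (T.v2 Δ)) (b.regionLift x c (T.v3 Δ))
      (T.edgeVar c (T.face Δ 0)) (T.edgeVar c (T.face Δ 2))
      (T.edgeVar (b.shift x c) (T.face Δ 0)) (T.edgeVar (b.shift x c) (T.face Δ 2)) := by
  rw [trianglePhase, prismPhase]
  congr 1
  · congr 1
    · split_ifs with h <;> simp [regionLift, h]
    · split_ifs with h <;> simp [regionLift, h]
  · split_ifs with h <;> simp [regionLift, h]

/-- The product of the cocycles above an edge when the region is lifted by `y` and then by `x`. -/
noncomputable def edgeStackPhase (ω : G → G → G → Circle) (x y : G) (c : Config V E G) (e : E) :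
    Circle :=
  stackPhase ω (T.tgt e ∈ R) (T.src e ∈ R) (b.regionLift x c (T.tgt e))
    (b.regionLift x c (T.src e)) (b.regionLift y c (T.tgt e)) (b.regionLift y c (T.src e))
    (T.edgeVar c e) (T.edgeVar (b.shift y c) e) (T.edgeVar (b.shift (x * y) c) e)

/-! ### Composition of the phases -/

section Stacking

variable {ω : G → G → G → Circle}

theorem edgeStackPhase_eq_one (x y : G) (c : Config V E G) {e : E} (hs : T.src e ∉ R)
    (ht : T.tgt e ∉ R) : b.edgeStackPhase ω x y c e = 1 := by
  simp [edgeStackPhase, stackPhase, hs, ht]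

theorem trianglePhase_mul (hω : IsThreeCocycle ω) {x y : G} {c : Config V E G}
    (hc : FlatNearLoop T R c) (hx : Commute x (b.holonomy c)) (hy : Commute y (b.holonomy c))
    {Δ : F} (hΔ : T.Crosses R Δ) :
    b.trianglePhase ω x (b.shift y c) Δ * b.trianglePhase ω y c Δ =
      b.trianglePhase ω (x * y) c Δ * T.coboundary (b.edgeStackPhase ω x y c) Δ := by
  have hx' : Commute x (b.holonomy (b.shift y c)) := by rwa [holonomy_shift]
  have hc' := b.flatNearLoop_shift hc hy
  have hc'' := b.flatNearLoop_shift hc' hx'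
  have h0 := b.edgeVar_shift_face_mul hΔ 0 hy
  have h2 := b.edgeVar_shift_face_mul hΔ 2 hy
  have h0' := b.edgeVar_shift_face_mul hΔ 0 hx'
  have h2' := b.edgeVar_shift_face_mul hΔ 2 hx'
  rw [shift_shift] at h0' h2' hc''
  simp only [regionLift_shift] at h0' h2'
  rw [T.src_face_zero] at h0 h0'
  have key := prismPhase_mul_prismPhase hω (p₁ := T.v1 Δ ∈ R) (p₂ := T.v2 Δ ∈ R)
    (p₃ := T.v3 Δ ∈ R) (b.regionLift_of_notMem x c) (b.regionLift_of_notMem x c)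
    (b.regionLift_of_notMem x c) (b.regionLift_of_notMem y c) (b.regionLift_of_notMem y c)
    (b.regionLift_of_notMem y c) h0 h2 h0' h2' (edgeVar_mul_of_flat hc hΔ)
    (edgeVar_mul_of_flat hc' hΔ) (edgeVar_mul_of_flat hc'' hΔ)
  simp only [trianglePhase_eq, regionLift_mul, regionLift_shift, shift_shift]
  rw [key]
  simp only [coboundary, edgeStackPhase, T.src_face_zero, ← T.tgt_face_zero, T.src_face_one]
  rfl

/-- Inside the region the lifts do not change the edge variable, so the wall over the edge consists
of the three tetrahedra of a `γ`. -/
theorem edgeStackPhase_of_mem {x y : G} {c : Config V E G} {e : E} (hs : T.src e ∈ R)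
    (ht : T.tgt e ∈ R)
    (hx : b.transport x c (T.tgt e) * c.2 e = c.2 e * b.transport x c (T.src e))
    (hy : b.transport y c (T.tgt e) * c.2 e = c.2 e * b.transport y c (T.src e)) :
    b.edgeStackPhase ω x y c e =
      (slantGamma ω (T.edgeVar c e) (b.lift x c (T.tgt e)) (b.lift y c (T.tgt e)))⁻¹ := by
  have e1 : ∀ z, T.edgeVar (b.shift z c) e = T.edgeVar c e := fun z => by
    rw [edgeVar, edgeVar, b.shift_snd_of_mem z c (iff_of_true hs ht), shift_fst]
  have kx := b.edgeVar_shift_mul x c (e := e) fun _ _ => hx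
  have ky := b.edgeVar_shift_mul y c (e := e) fun _ _ => hy
  rw [e1, b.regionLift_of_mem x c hs, b.regionLift_of_mem x c ht] at kx
  rw [e1, b.regionLift_of_mem y c hs, b.regionLift_of_mem y c ht] at ky
  rw [slantGamma_eq_of_conj kx ky, inv_div, edgeStackPhase]
  simp only [stackPhase, hs, ht, and_self, if_true, e1, regionLift]

/-- The phase `γ` of the edge `k → k + 1` of the loop. -/
noncomputable def edgeGamma (ω : G → G → G → Circle) (x y : G) (c : Config V E G) (k : Fin b.m) :
    Circle :=
  slantGamma ω (T.edgeVar c (b.edge k)) (b.lift x c (b.vtx k.succ)) (b.lift y c (b.vtx k.succ))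

/-- The walls over all edges meeting the region cancel between neighbouring crossed triangles,
except those over the loop. -/
theorem phaseW_mul [Fintype E] (hω : IsThreeCocycle ω) {x y : G} {c : Config V E G}
    (hc : FlatNearLoop T R c) (hx : Commute x (b.holonomy c)) (hy : Commute y (b.holonomy c)) :
    b.phaseW ω x (b.shift y c) * b.phaseW ω y c = b.phaseW ω (x * y) c *
      ((∏ k, b.edgeGamma ω x y c k) /
        slantGamma ω (T.edgeVar c b.closing) (b.lift x c b.ref) (b.lift y c b.ref)) := by
  have h := b.prod_coboundary_crosses (β := b.edgeStackPhase ω x y c)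
    fun e hs ht => b.edgeStackPhase_eq_one x y c hs ht
  have hk : ∀ k, b.edgeStackPhase ω x y c (b.edge k) = (b.edgeGamma ω x y c k)⁻¹ := fun k => by
    rw [b.edgeStackPhase_of_mem (b.edge_mem k).1 (b.edge_mem k).2 (b.transport_edge x c k)
      (b.transport_edge y c k), b.tgt_edge, edgeGamma]
  rw [b.edgeStackPhase_of_mem b.closing_mem.1 b.closing_mem.2 (b.transport_closing hx)
    (b.transport_closing hy), Finset.prod_congr rfl fun k _ => hk k, Finset.prod_inv_distrib,
    inv_div_inv, b.tgt_closing] at h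
  rw [ref, ← h, phaseW, phaseW, phaseW, ← Finset.prod_mul_distrib, ← Finset.prod_mul_distrib]
  refine Finset.prod_congr rfl fun Δ _ => ?_
  by_cases hΔ : T.Crosses R Δ
  · simp only [if_pos hΔ, ← mul_zpow, b.trianglePhase_mul hω hc hx hy hΔ]
  · simp [if_neg hΔ]

/-- The gauge invariant parallel transport `g_k h^path_{k,1} g_1⁻¹`. -/
def pathVar (c : Config V E G) (k : Fin (b.m + 1)) : G :=
  c.1 (b.vtx k) * b.path c k * (c.1 (b.vtx 0))⁻¹

theorem edgeVar_mul_pathVar (c : Config V E G) (k : Fin b.m) :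
    T.edgeVar c (b.edge k) * b.pathVar c k.castSucc = b.pathVar c k.succ := by
  rw [edgeVar, pathVar, pathVar, path_succ, b.tgt_edge, b.src_edge]
  group

theorem pathVar_zero (c : Config V E G) : b.pathVar c 0 = 1 := by
  rw [pathVar, path_zero]
  group

theorem dressedHolonomy_mul_edgeVar (c : Config V E G) :
    b.dressedHolonomy c * T.edgeVar c b.closing = b.pathVar c (Fin.last b.m) := by
  rw [dressedHolonomy, edgeVar, pathVar, holonomy, b.tgt_closing, b.src_closing, ref]
  group

theorem edgeVar_conj_lift (x : G) (c : Config V E G) (k : Fin b.m) :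
    (T.edgeVar c (b.edge k))⁻¹ * b.lift x c (b.vtx k.succ) * T.edgeVar c (b.edge k) =
      b.lift x c (b.vtx k.castSucc) := by
  have h := b.transport_edge x c k
  rw [b.tgt_edge, b.src_edge] at h
  rw [edgeVar, lift, lift, b.tgt_edge, b.src_edge]
  have h' : b.transport x c (b.vtx k.castSucc) = (c.2 (b.edge k))⁻¹ *
      (b.transport x c (b.vtx k.succ) * c.2 (b.edge k)) := by rw [h]; group
  rw [h']
  group

theorem phaseThetaTilde_eq (x : G) (c : Config V E G) :
    b.phaseThetaTilde ω x c = ∏ k : Fin b.m, if 0 < (k : ℕ) then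
      slantTheta ω (b.lift x c (b.vtx k.succ)) (T.edgeVar c (b.edge k))
        (b.pathVar c k.castSucc) else 1 := rfl

theorem phaseThetaTilde_shift (x y : G) (c : Config V E G) :
    b.phaseThetaTilde ω x (b.shift y c) = b.phaseThetaTilde ω x c := by
  simp only [phaseThetaTilde, lift_shift, edgeVar_shift_edge, path_shift, shift_fst]

theorem phaseTheta_shift (x y : G) (c : Config V E G) :
    b.phaseTheta ω x (b.shift y c) = b.phaseTheta ω x c := by
  simp only [phaseTheta, phaseThetaTilde_shift, lift_shift, edgeVar_shift_closing,
    dressedHolonomy_shift]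

/-- Item 1, applied to a loop edge and the path before it, expresses the defect of one `θ` through
the `γ` of the longer path, of the shorter path and of the edge. No condition on the holonomy
enters, since the closing edge does not occur. -/
theorem phaseThetaTilde_mul (hω : IsThreeCocycle ω) (x y : G) (c : Config V E G) :
    b.phaseThetaTilde ω x c * b.phaseThetaTilde ω y c = b.phaseThetaTilde ω (x * y) c *
      (slantGamma ω (b.pathVar c (Fin.last b.m)) (b.lift x c b.ref) (b.lift y c b.ref) /
        ∏ k, b.edgeGamma ω x y c k) := by
  -- The value at `0` is set to `1` rather than to the `γ` of the trivial path, which need not be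
  -- `1`. The first edge has no `θ` factor, and there the path is the edge itself, so its `γ`
  -- cancels.
  let Γ : Fin (b.m + 1) → Circle := fun k => if k = 0 then 1 else
    slantGamma ω (b.pathVar c k) (b.lift x c (b.vtx k)) (b.lift y c (b.vtx k))
  have hm : Fin.last b.m ≠ 0 := by
    have := b.two_le
    simp only [ne_eq, Fin.ext_iff, Fin.val_last, Fin.val_zero]
    omega
  have hΓ : slantGamma ω (b.pathVar c (Fin.last b.m)) (b.lift x c b.ref) (b.lift y c b.ref) =
      ∏ k : Fin b.m, Γ k.succ / Γ k.castSucc := by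
    rw [Fin.prod_univ_div_telescope]
    simp only [Γ, if_neg hm, if_true, div_one, ref]
  rw [hΓ]
  simp only [phaseThetaTilde_eq]
  rw [← Finset.prod_div_distrib, ← Finset.prod_mul_distrib, ← Finset.prod_mul_distrib]
  refine Finset.prod_congr rfl fun k _ => ?_
  have hs : Γ k.succ = slantGamma ω (b.pathVar c k.succ) (b.lift x c (b.vtx k.succ))
      (b.lift y c (b.vtx k.succ)) := if_neg (Fin.succ_ne_zero k)
  by_cases hk : 0 < (k : ℕ)
  · have hcs : Γ k.castSucc = slantGamma ω (b.pathVar c k.castSucc) (b.lift x c (b.vtx k.castSucc))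
        (b.lift y c (b.vtx k.castSucc)) := if_neg fun h => by
      have := congrArg Fin.val h
      simp only [Fin.val_castSucc, Fin.val_zero] at this
      omega
    have key := slantTheta_mul_slantGamma hω (b.lift x c (b.vtx k.succ))
      (b.lift y c (b.vtx k.succ)) (T.edgeVar c (b.edge k)) (b.pathVar c k.castSucc)
    rw [edgeVar_conj_lift, edgeVar_conj_lift, edgeVar_mul_pathVar, ← lift_mul, ← hcs, ← hs] at key
    simp only [if_pos hk, edgeGamma]
    rw [div_div, ← mul_div_assoc, eq_div_iff_mul_eq', ← key]
    simp only [mul_comm, mul_left_comm]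
  · have h0 : k.castSucc = 0 := by
      rw [Fin.ext_iff, Fin.val_castSucc, Fin.val_zero]
      omega
    have hp := b.edgeVar_mul_pathVar c k
    rw [h0, pathVar_zero, mul_one] at hp
    have hcs : Γ k.castSucc = 1 := if_pos h0
    simp only [if_neg hk, hcs, hs, edgeGamma, hp, one_mul, div_one, div_self']

theorem lift_ref (x : G) (c : Config V E G) :
    b.lift x c b.ref = c.1 b.ref * x * (c.1 b.ref)⁻¹ := by
  rw [lift, transport_ref]

theorem phaseTheta_mul (hω : IsThreeCocycle ω) {x y : G} {c : Config V E G}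
    (hx : Commute x (b.holonomy c)) (hy : Commute y (b.holonomy c)) :
    b.phaseTheta ω x c * b.phaseTheta ω y c = b.phaseTheta ω (x * y) c *
      (slantGamma ω (b.dressedHolonomy c) (b.lift x c b.ref) (b.lift y c b.ref) *
        (slantGamma ω (T.edgeVar c b.closing) (b.lift x c b.ref) (b.lift y c b.ref) /
          ∏ k, b.edgeGamma ω x y c k)) := by
  -- The dressed holonomy commutes with the lifted elements at the reference vertex, so both `γ`
  -- factors on the left of item 1 have the same entries.
  have conj : ∀ {z : G}, Commute z (b.holonomy c) →
      (b.dressedHolonomy c)⁻¹ * b.lift z c b.ref * b.dressedHolonomy c = b.lift z c b.ref := by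
    intro z hz
    have hz' : (b.holonomy c)⁻¹ * z * b.holonomy c = z := by rw [mul_assoc, hz.eq]; group
    rw [lift_ref, dressedHolonomy]
    conv_rhs => rw [← hz']
    group
  have key := slantTheta_mul_slantGamma hω (b.lift x c b.ref) (b.lift y c b.ref)
    (b.dressedHolonomy c) (T.edgeVar c b.closing)
  rw [conj hx, conj hy, dressedHolonomy_mul_edgeVar, ← lift_mul] at key
  have kt := b.phaseThetaTilde_mul hω x y c
  rw [phaseTheta, phaseTheta, phaseTheta, mul_mul_mul_comm, kt]
  have key' := eq_div_iff_mul_eq'.2 key.symm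
  apply Additive.ofMul.injective
  have key'' := congrArg Additive.ofMul key'
  simp only [ofMul_mul, ofMul_div, ofMul_inv] at key'' ⊢
  rw [key'']
  abel

theorem phaseW_mul_phaseTheta_mul [Fintype E] (hω : IsThreeCocycle ω) {x y : G}
    {c : Config V E G} (hc : FlatNearLoop T R c) (hx : Commute x (b.holonomy c))
    (hy : Commute y (b.holonomy c)) :
    b.phaseW ω x (b.shift y c) * b.phaseTheta ω x (b.shift y c) *
        (b.phaseW ω y c * b.phaseTheta ω y c) =
      b.phaseW ω (x * y) c * b.phaseTheta ω (x * y) c *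
        slantGamma ω (b.dressedHolonomy c) (b.lift x c b.ref) (b.lift y c b.ref) := by
  rw [mul_mul_mul_comm, b.phaseW_mul hω hc hx hy, phaseTheta_shift, b.phaseTheta_mul hω hx hy,
    mul_mul_mul_comm]
  congr 1
  rw [mul_left_comm, div_mul_div_cancel, div_self', mul_one]

/-- For trivial holonomy the whole path equals the closing edge, so the defects of `W` and `Θ̃` are
inverse to each other. -/
theorem phaseW_mul_phaseThetaTilde_mul [Fintype E] (hω : IsThreeCocycle ω) (x y : G)
    {c : Config V E G} (hc : FlatNearLoop T R c) (h : b.holonomy c = 1) :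
    b.phaseW ω x (b.shift y c) * b.phaseThetaTilde ω x (b.shift y c) *
        (b.phaseW ω y c * b.phaseThetaTilde ω y c) =
      b.phaseW ω (x * y) c * b.phaseThetaTilde ω (x * y) c := by
  have hP : b.pathVar c (Fin.last b.m) = T.edgeVar c b.closing := by
    rw [← dressedHolonomy_mul_edgeVar, dressedHolonomy, h]
    group
  rw [mul_mul_mul_comm, b.phaseW_mul hω hc (h ▸ Commute.one_right x) (h ▸ Commute.one_right y),
    phaseThetaTilde_shift, b.phaseThetaTilde_mul hω, hP, mul_mul_mul_comm, div_mul_div_cancel,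
    div_self', mul_one]

end Stacking

end BoundaryLoop

end BranchedTriangulation

namespace BranchedTriangulation

variable {V E F G : Type*} [DecidableEq V] [DecidableEq E] [Fintype F] [Group G]
  {T : BranchedTriangulation V E F}

/-- The amplitude of a configuration of the vertices in the fixed point state. -/
noncomputable def sptPhase (T : BranchedTriangulation V E F) (ω : G → G → G → Circle) (g : V → G) : Circle :=
  ∏ Δ : F, ω (g (T.v3 Δ) * (g (T.v2 Δ))⁻¹) (g (T.v2 Δ) * (g (T.v1 Δ))⁻¹) (g (T.v1 Δ))
    ^ (T.sign Δ : ℤ)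

namespace BoundaryLoop

variable {R : Finset V} (b : T.BoundaryLoop R)

theorem flatNearLoop_one {V E F G : Type*} [Group G] {T : BranchedTriangulation V E F}
    {R : Finset V} (g : V → G) : FlatNearLoop T R (g, fun _ : E => (1 : G)) :=
  fun _ _ => mul_one 1

theorem path_one (g : V → G) (k : Fin (b.m + 1)) : b.path (g, fun _ : E => (1 : G)) k = 1 := by
  induction k using Fin.induction with
  | zero => rfl
  | succ k ih => rw [path_succ, ih, mul_one]

theorem holonomy_one (g : V → G) : b.holonomy (g, fun _ : E => (1 : G)) = 1 := by
  rw [holonomy, path_one, inv_one, mul_one]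

theorem transport_one_vtx (x : G) (g : V → G) (k : Fin (b.m + 1)) :
    b.transport x (g, fun _ : E => (1 : G)) (b.vtx k) = x := by
  rw [transport_vtx, transportAt, path_one, path_one]
  group

theorem exists_face {e : E} (h : T.src e ∈ R ∨ T.tgt e ∈ R) (b : T.BoundaryLoop R) :
    ∃ Δ i, T.face Δ i = e := by
  obtain ⟨Δ, i, -, -, -, h, -⟩ := b.interior e h
  exact ⟨Δ, i, h⟩

/-! ### Locality of the phases and of the shift -/

section Support

theorem edge_mem_supportEdges (k : Fin b.m) : b.edge k ∈ b.supportEdges :=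
  Or.inl (Or.inl ⟨k, rfl⟩)

theorem mem_supportEdges_of_edgeCrosses {e : E} (h : T.EdgeCrosses R e) : e ∈ b.supportEdges := by
  obtain ⟨Δ, i, rfl⟩ := exists_face (h.imp And.left And.left) b
  exact Or.inr ⟨Δ, i, T.crosses_of_edgeCrosses h, rfl⟩

theorem shift_snd_of_not_edgeCrosses (x : G) (c : Config V E G) {e : E}
    (h : ¬ T.EdgeCrosses R e) : (b.shift x c).2 e = c.2 e := by
  refine b.shift_snd_of_mem x c ?_
  unfold EdgeCrosses Xor at h
  tauto

variable {c d : Config V E G}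

theorem shift_eqOn (hE : Set.EqOn c.2 d.2 b.supportEdges) (x : G) : Set.EqOn (b.shift x c).2 (b.shift x d).2 b.supportEdges := by
  intro e he
  have ht := b.transport_congr x (c := c) (d := d) fun k => hE (b.edge_mem_supportEdges k)
  simp only [shift, ht, hE he]

theorem lift_eq_of_eqOn (hV : Set.EqOn c.1 d.1 b.supportVertices)
    (hE : Set.EqOn c.2 d.2 b.supportEdges) (x : G) {v : V} (hv : v ∈ b.supportVertices) :
    b.lift x c v = b.lift x d v := by
  rw [lift, lift, hV hv, b.transport_congr x fun k => hE (b.edge_mem_supportEdges k)]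

theorem edgeVar_eq_of_eqOn (hV : Set.EqOn c.1 d.1 b.supportVertices)
    (hE : Set.EqOn c.2 d.2 b.supportEdges) {e : E} (he : e ∈ b.supportEdges) (hs : T.src e ∈ b.supportVertices)
    (ht : T.tgt e ∈ b.supportVertices) : T.edgeVar c e = T.edgeVar d e := by
  rw [edgeVar, edgeVar, hV hs, hV ht, hE he]

theorem phaseW_eq_of_eqOn (hV : Set.EqOn c.1 d.1 b.supportVertices)
    (hE : Set.EqOn c.2 d.2 b.supportEdges) (ω : G → G → G → Circle) (x : G) :
    b.phaseW ω x c = b.phaseW ω x d := by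
  refine Finset.prod_congr rfl fun Δ _ => ?_
  by_cases hΔ : T.Crosses R Δ
  · have h1 : T.v1 Δ ∈ b.supportVertices := Or.inr ⟨Δ, hΔ, Or.inl rfl⟩
    have h2 : T.v2 Δ ∈ b.supportVertices := Or.inr ⟨Δ, hΔ, Or.inr (Or.inl rfl)⟩
    have h3 : T.v3 Δ ∈ b.supportVertices := Or.inr ⟨Δ, hΔ, Or.inr (Or.inr rfl)⟩
    have hf : ∀ i, T.face Δ i ∈ b.supportEdges := fun i => Or.inr ⟨Δ, i, hΔ, rfl⟩
    have h0s : T.src (T.face Δ 0) ∈ b.supportVertices := T.src_face_zero Δ ▸ h2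
    have hS := b.shift_eqOn hE x
    have hV' : Set.EqOn (b.shift x c).1 (b.shift x d).1 b.supportVertices := hV
    have l1 := b.lift_eq_of_eqOn hV hE x h1
    have l2 := b.lift_eq_of_eqOn hV hE x h2
    have l3 := b.lift_eq_of_eqOn hV hE x h3
    have e0 := b.edgeVar_eq_of_eqOn hV hE (hf 0) h0s h3
    have e2 := b.edgeVar_eq_of_eqOn hV hE (hf 2) h1 h2
    have e0' := b.edgeVar_eq_of_eqOn hV' hS (hf 0) h0s h3
    have e2' := b.edgeVar_eq_of_eqOn hV' hS (hf 2) h1 h2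
    simp only [trianglePhase, l1, l2, l3, e0, e2, e0', e2']
  · simp only [if_neg hΔ]

theorem phaseThetaTilde_eq_of_eqOn (hV : Set.EqOn c.1 d.1 b.supportVertices)
    (hE : Set.EqOn c.2 d.2 b.supportEdges) (ω : G → G → G → Circle) (x : G) :
    b.phaseThetaTilde ω x c = b.phaseThetaTilde ω x d := by
  have hv : ∀ k, b.vtx k ∈ b.supportVertices := fun k => Or.inl ⟨k, rfl⟩
  refine Finset.prod_congr rfl fun k _ => ?_
  rw [b.lift_eq_of_eqOn hV hE x (hv _), b.edgeVar_eq_of_eqOn hV hE (b.edge_mem_supportEdges k)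
    (b.src_edge k ▸ hv _) (b.tgt_edge k ▸ hv _), hV (hv _), hV (hv _),
    b.path_congr fun k => hE (b.edge_mem_supportEdges k)]

end Support

/-! ### The gauge transformed amplitude -/

section Gauge

variable {ω : G → G → G → Circle}

/-- Right multiplication by `x` on the vertices of the region. -/
def mulRegion {V G : Type*} [DecidableEq V] [Group G] (R : Finset V) (x : G) (g : V → G) : V → G :=
  fun v => if v ∈ R then g v * x else g v

/-- The element that lifts `g_v` to `g_v x` on the region. -/
def conjRegion {V G : Type*} [DecidableEq V] [Group G] (R : Finset V) (x : G) (g : V → G) (v : V) :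
    G := if v ∈ R then g v * x * (g v)⁻¹ else 1

theorem conjRegion_mul {V G : Type*} [DecidableEq V] [Group G] {R : Finset V} (x : G) (g : V → G) (v : V) :
    conjRegion R x g v * g v = mulRegion R x g v := by
  by_cases h : v ∈ R <;> simp [conjRegion, mulRegion, h]

theorem mulRegion_div_mul {V G : Type*} [DecidableEq V] [Group G] {R : Finset V} (x : G) (g : V → G) (v w : V) :
    mulRegion R x g w * (mulRegion R x g v)⁻¹ * conjRegion R x g v =
      conjRegion R x g w * (g w * (g v)⁻¹) := by
  rw [← conjRegion_mul, ← conjRegion_mul]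
  group

theorem regionLift_one_of_crosses (x : G) (g : V → G) {Δ : F} (hΔ : T.Crosses R Δ) {v : V}
    (hv : v = T.v1 Δ ∨ v = T.v2 Δ ∨ v = T.v3 Δ) :
    b.regionLift x (g, fun _ : E => (1 : G)) v = conjRegion R x g v := by
  by_cases h : v ∈ R
  · obtain ⟨k, rfl⟩ := b.exists_vtx_of_crosses hΔ hv h
    rw [regionLift_of_mem _ _ _ h, conjRegion, if_pos h, lift, transport_one_vtx]
  · rw [regionLift_of_notMem _ _ _ h, conjRegion, if_neg h]

theorem edgeVar_one {V E F G : Type*} [Group G] {T : BranchedTriangulation V E F} (g : V → G) (e : E) :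
    T.edgeVar (g, fun _ : E => (1 : G)) e = g (T.tgt e) * (g (T.src e))⁻¹ := by
  rw [edgeVar, mul_one]

theorem edgeVar_shift_one_of_crosses (x : G) (g : V → G) {Δ : F} (hΔ : T.Crosses R Δ)
    {i : Fin 3} {v w : V} (hs : T.src (T.face Δ i) = v) (ht : T.tgt (T.face Δ i) = w)
    (hv : v = T.v1 Δ ∨ v = T.v2 Δ ∨ v = T.v3 Δ) (hw : w = T.v1 Δ ∨ w = T.v2 Δ ∨ w = T.v3 Δ) :
    T.edgeVar (b.shift x (g, fun _ : E => (1 : G))) (T.face Δ i) =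
      mulRegion R x g w * (mulRegion R x g v)⁻¹ := by
  have h := b.edgeVar_shift_face_mul hΔ i (x := x) (c := (g, fun _ : E => (1 : G)))
    (by rw [holonomy_one]; exact Commute.one_right x)
  rw [edgeVar_one, hs, ht, b.regionLift_one_of_crosses x g hΔ hv,
    b.regionLift_one_of_crosses x g hΔ hw, ← mulRegion_div_mul] at h
  exact mul_right_cancel h

/-- The prism over a triangle with trivial edges whose vertices in the region are lifted by `x`. -/
noncomputable def regionPrismPhase (T : BranchedTriangulation V E F) (R : Finset V)
    (ω : G → G → G → Circle) (x : G) (g : V → G) (Δ : F) : Circle :=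
  prismPhase ω (T.v1 Δ ∈ R) (T.v2 Δ ∈ R) (T.v3 Δ ∈ R) (conjRegion R x g (T.v1 Δ))
    (conjRegion R x g (T.v2 Δ)) (conjRegion R x g (T.v3 Δ)) (g (T.v3 Δ) * (g (T.v2 Δ))⁻¹)
    (g (T.v2 Δ) * (g (T.v1 Δ))⁻¹) (mulRegion R x g (T.v3 Δ) * (mulRegion R x g (T.v2 Δ))⁻¹)
    (mulRegion R x g (T.v2 Δ) * (mulRegion R x g (T.v1 Δ))⁻¹)

theorem trianglePhase_one (x : G) (g : V → G) {Δ : F} (hΔ : T.Crosses R Δ) :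
    b.trianglePhase ω x (g, fun _ : E => (1 : G)) Δ = regionPrismPhase T R ω x g Δ := by
  have m1 : T.v1 Δ = T.v1 Δ ∨ T.v1 Δ = T.v2 Δ ∨ T.v1 Δ = T.v3 Δ := Or.inl rfl
  have m2 : T.v2 Δ = T.v1 Δ ∨ T.v2 Δ = T.v2 Δ ∨ T.v2 Δ = T.v3 Δ := Or.inr (Or.inl rfl)
  have m3 : T.v3 Δ = T.v1 Δ ∨ T.v3 Δ = T.v2 Δ ∨ T.v3 Δ = T.v3 Δ := Or.inr (Or.inr rfl)
  rw [trianglePhase_eq, b.regionLift_one_of_crosses x g hΔ m1,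
    b.regionLift_one_of_crosses x g hΔ m2, b.regionLift_one_of_crosses x g hΔ m3,
    b.edgeVar_shift_one_of_crosses x g hΔ (i := 0) (T.src_face_zero Δ) rfl m2 m3,
    b.edgeVar_shift_one_of_crosses x g hΔ (i := 2) rfl rfl m1 m2, edgeVar_one, edgeVar_one,
    T.src_face_zero]
  rfl

/-- The 1-cochain whose coboundary is the slant product on the triangles of the region. -/
noncomputable def edgeTheta (T : BranchedTriangulation V E F) (ω : G → G → G → Circle) (x g₀ : G)
    (g : V → G) (e : E) : Circle :=
  slantTheta ω (g (T.tgt e) * x * (g (T.tgt e))⁻¹) (g (T.tgt e) * (g (T.src e))⁻¹)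
    (g (T.src e) * g₀⁻¹)

/-- Right multiplication by `x` at all three vertices leaves the edge variables alone, so the prism
is a `θ`. The 2-cocycle relation with third entry `g₁ g₀⁻¹` provides its primitive. -/
theorem regionPrismPhase_of_inRegion {V E F G : Type*} [DecidableEq V] [Group G]
    {T : BranchedTriangulation V E F} {R : Finset V} {ω : G → G → G → Circle} (hω : IsThreeCocycle ω) (x g₀ : G) (g : V → G) {Δ : F}
    (hΔ : T.InRegion R Δ) :
    regionPrismPhase T R ω x g Δ = T.coboundary (edgeTheta T ω x g₀ g) Δ := by
  obtain ⟨h1, h2, h3⟩ := hΔ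
  have hd : ∀ {v w}, v ∈ R → w ∈ R → mulRegion R x g w * (mulRegion R x g v)⁻¹ =
      g w * (g v)⁻¹ := fun hv hw => by
    rw [mulRegion, mulRegion, if_pos hv, if_pos hw]
    group
  have e32 := mulRegion_div_mul (R := R) x g (T.v2 Δ) (T.v3 Δ)
  have e21 := mulRegion_div_mul (R := R) x g (T.v1 Δ) (T.v2 Δ)
  rw [hd h2 h3] at e32
  rw [hd h1 h2] at e21
  rw [regionPrismPhase, hd h2 h3, hd h1 h2, prismPhase_eq_slantTheta h1 h2 h3 e32 e21]
  have key := slantTheta_cocycle hω (g (T.v3 Δ) * x * (g (T.v3 Δ))⁻¹)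
    (g (T.v3 Δ) * (g (T.v2 Δ))⁻¹) (g (T.v2 Δ) * (g (T.v1 Δ))⁻¹) (g (T.v1 Δ) * g₀⁻¹)
  have a1 : g (T.v3 Δ) * (g (T.v2 Δ))⁻¹ * (g (T.v2 Δ) * (g (T.v1 Δ))⁻¹) =
    g (T.v3 Δ) * (g (T.v1 Δ))⁻¹ := by group
  have a2 : g (T.v2 Δ) * (g (T.v1 Δ))⁻¹ * (g (T.v1 Δ) * g₀⁻¹) = g (T.v2 Δ) * g₀⁻¹ := by group
  have a3 : (g (T.v3 Δ) * (g (T.v2 Δ))⁻¹)⁻¹ * (g (T.v3 Δ) * x * (g (T.v3 Δ))⁻¹) *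
    (g (T.v3 Δ) * (g (T.v2 Δ))⁻¹) = g (T.v2 Δ) * x * (g (T.v2 Δ))⁻¹ := by group
  rw [a1, a2, a3] at key
  simp only [coboundary, edgeTheta, T.src_face_zero, T.src_face_one, ← T.tgt_face_zero]
  rw [conjRegion, if_pos h3, eq_div_iff_mul_eq']
  exact key

theorem prod_edgeTheta [Fintype E] (hω : IsThreeCocycle ω) (x : G) (g : V → G) :
    (∏ k, edgeTheta T ω x (g (b.vtx 0)) g (b.edge k)) /
        edgeTheta T ω x (g (b.vtx 0)) g b.closing =
      b.phaseThetaTilde ω x (g, fun _ : E => (1 : G)) := by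
  -- The first and the closing edge both start at the base vertex, so their last entry is `1` and
  -- they carry the same factor. They cancel, which is why the product in `Θ̃` omits the first edge.
  have h0 : ∀ e, T.src e = b.vtx 0 → edgeTheta T ω x (g (b.vtx 0)) g e =
      slantTheta ω (g (b.vtx 0) * x * (g (b.vtx 0))⁻¹) 1 1 := fun e he => by
    rw [edgeTheta, he, mul_inv_cancel, slantTheta_one_right hω]
    congr 1
    group
  have hk : ∀ k : Fin b.m, 0 < (k : ℕ) → edgeTheta T ω x (g (b.vtx 0)) g (b.edge k) =
      slantTheta ω (b.lift x (g, fun _ : E => (1 : G)) (b.vtx k.succ))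
        (T.edgeVar (g, fun _ : E => (1 : G)) (b.edge k))
        (b.pathVar (g, fun _ : E => (1 : G)) k.castSucc) := fun k _ => by
    rw [edgeTheta, edgeVar_one, lift, transport_one_vtx, pathVar, path_one, b.tgt_edge,
      b.src_edge, mul_one]
  rw [h0 _ b.src_closing, phaseThetaTilde_eq, div_eq_iff_eq_mul]
  have hm : 0 < b.m := by have := b.two_le; omega
  rw [← Finset.mul_prod_erase _ _ (Finset.mem_univ (⟨0, hm⟩ : Fin b.m)),
    ← Finset.mul_prod_erase _ (fun k : Fin b.m => if 0 < (k : ℕ) then _ else _)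
      (Finset.mem_univ (⟨0, hm⟩ : Fin b.m)), if_neg (lt_irrefl _), one_mul, mul_comm,
    h0 (b.edge ⟨0, hm⟩) (b.src_edge ⟨0, hm⟩)]
  congr 1
  refine Finset.prod_congr rfl fun k hk' => ?_
  have : 0 < (k : ℕ) := by
    have := Finset.ne_of_mem_erase hk'
    rw [ne_eq, Fin.ext_iff] at this
    exact Nat.pos_of_ne_zero this
  rw [if_pos this, hk k this]

theorem sptPhase_mulRegion [Fintype E] (hω : IsThreeCocycle ω) (x : G) (g : V → G) :
    T.sptPhase ω (mulRegion R x g) = T.sptPhase ω g *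
      (b.phaseW ω x (g, fun _ : E => (1 : G)) *
        b.phaseThetaTilde ω x (g, fun _ : E => (1 : G))) := by
  let β : E → Circle := fun e => conePhase ω (T.tgt e ∈ R) (T.src e ∈ R)
    (conjRegion R x g (T.tgt e)) (conjRegion R x g (T.src e)) (g (T.src e))
    (g (T.tgt e) * (g (T.src e))⁻¹)
    (mulRegion R x g (T.tgt e) * (mulRegion R x g (T.src e))⁻¹)
  -- The faces of the cones cancel in pairs: they differ from `1` only over edges meeting the
  -- region, which are interior.
  have hβ : ∏ Δ : F, T.coboundary β Δ ^ (T.sign Δ : ℤ) = 1 :=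
    b.prod_coboundary_eq_one fun e hs ht => by simp [β, conePhase, hs, ht]
  have hΔ : ∀ Δ, ω (mulRegion R x g (T.v3 Δ) * (mulRegion R x g (T.v2 Δ))⁻¹)
      (mulRegion R x g (T.v2 Δ) * (mulRegion R x g (T.v1 Δ))⁻¹) (mulRegion R x g (T.v1 Δ)) =
      ω (g (T.v3 Δ) * (g (T.v2 Δ))⁻¹) (g (T.v2 Δ) * (g (T.v1 Δ))⁻¹) (g (T.v1 Δ)) *
        (regionPrismPhase T R ω x g Δ * T.coboundary β Δ) := fun Δ => by
    have key := cocycle_lift_eq_prismPhase_mul hω (p₁ := T.v1 Δ ∈ R) (p₂ := T.v2 Δ ∈ R)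
      (p₃ := T.v3 Δ ∈ R) (X₁ := conjRegion R x g (T.v1 Δ)) (X₂ := conjRegion R x g (T.v2 Δ))
      (X₃ := conjRegion R x g (T.v3 Δ)) (fun h => if_neg h) (fun h => if_neg h)
      (fun h => if_neg h) (mulRegion_div_mul x g (T.v2 Δ) (T.v3 Δ))
      (mulRegion_div_mul x g (T.v1 Δ) (T.v2 Δ))
      (ab := g (T.v3 Δ) * (g (T.v1 Δ))⁻¹)
      (ab' := mulRegion R x g (T.v3 Δ) * (mulRegion R x g (T.v1 Δ))⁻¹)
      (g₁ := g (T.v1 Δ)) (g₂ := g (T.v2 Δ)) (by group) (by group) (by group)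
    rw [conjRegion_mul] at key
    rw [key]
    simp only [coboundary, β, T.src_face_zero, T.src_face_one, ← T.tgt_face_zero]
    rfl
  have hprod : ∏ Δ : F, regionPrismPhase T R ω x g Δ ^ (T.sign Δ : ℤ) =
      b.phaseW ω x (g, fun _ : E => (1 : G)) *
        b.phaseThetaTilde ω x (g, fun _ : E => (1 : G)) := by
    rw [← b.prod_edgeTheta hω, ← b.prod_coboundary_inRegion, phaseW, ← Finset.prod_mul_distrib]
    refine Finset.prod_congr rfl fun Δ _ => ?_
    by_cases h1 : T.InRegion R Δ
    · have h2 : ¬ T.Crosses R Δ := fun h => h.2 h1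
      rw [if_neg h2, if_pos h1, one_mul, regionPrismPhase_of_inRegion hω x (g (b.vtx 0)) g h1]
    · by_cases h2 : T.Crosses R Δ
      · rw [if_pos h2, if_neg h1, mul_one, b.trianglePhase_one x g h2]
      · have h3 : ¬ T.Meets R Δ := fun h => h2 ⟨h, h1⟩
        unfold Meets at h3
        push Not at h3
        rw [if_neg h2, if_neg h1, mul_one, regionPrismPhase, prismPhase, if_neg h3.1,
          if_neg h3.2.1, if_neg h3.2.2]
        simp
  rw [← hprod, sptPhase, sptPhase, ← Finset.prod_mul_distrib]
  simp only [hΔ, mul_zpow, Finset.prod_mul_distrib, hβ, mul_one]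

/-- With trivial edges the transported element is `x` at every loop vertex. On edges inside the
region the gauge transformation gives `x x⁻¹ = 1`, in agreement with the shift, which leaves them
alone. -/
theorem shift_one_eq (x : G) (g : V → G) :
    b.shift x (g, fun _ : E => (1 : G)) =
      (g, fun e => (if T.tgt e ∈ R then x else 1) * 1 * (if T.src e ∈ R then x⁻¹ else 1)) := by
  refine Prod.ext rfl (funext fun e => ?_)
  have hl : T.EdgeCrosses R e → ∀ v ∈ R, (v = T.src e ∨ v = T.tgt e) →
      b.transport x (g, fun _ : E => (1 : G)) v = x := fun he v hv h => by
    obtain ⟨k, rfl⟩ := b.mem_loop e he v hv h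
    exact b.transport_one_vtx x g k
  by_cases hs : T.src e ∈ R <;> by_cases ht : T.tgt e ∈ R
  · simp [shift, hs, ht]
  · simp [shift, hs, ht, hl (Or.inl ⟨hs, ht⟩) _ hs (Or.inl rfl)]
  · simp [shift, hs, ht, hl (Or.inr ⟨ht, hs⟩) _ ht (Or.inr rfl)]
  · simp [shift, hs, ht]

end Gauge

end BoundaryLoop

end BranchedTriangulation

/-! ### From configurations to operators -/

section Operators

variable {V E G : Type*} [Fintype V] [DecidableEq V] [Fintype E] [DecidableEq E]
  [Fintype G] [DecidableEq G]

theorem relabelOp_ket (f : Config V E G → Config V E G) (c : Config V E G) :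
    relabelOp f (ket c) = ket (f c) := opOfKets_ket _ c

theorem diagOp_ket (φ : Config V E G → ℂ) (c : Config V E G) :
    diagOp φ (ket c) = φ c • ket c := opOfKets_ket _ c

theorem relabelOp_mul_diagOp_ket (f : Config V E G → Config V E G) (φ : Config V E G → ℂ)
    (c : Config V E G) : (relabelOp f * diagOp φ) (ket c) = φ c • ket (f c) := by
  rw [Module.End.mul_apply, diagOp_ket, map_smul, relabelOp_ket]

/-- Matrix elements live on the graph of `f`. Outside the support `f` is the identity, and inside it
both `f` and `φ` depend on the labels there only. -/
theorem isSupportedOn_relabelOp_mul_diagOp {f : Config V E G → Config V E G}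
    {φ : Config V E G → ℂ} {DV : Set V} {DE : Set E}
    (hout : ∀ c, Set.EqOn (f c).1 c.1 DVᶜ ∧ Set.EqOn (f c).2 c.2 DEᶜ)
    (hin : ∀ c d, Set.EqOn c.1 d.1 DV → Set.EqOn c.2 d.2 DE →
      Set.EqOn (f c).1 (f d).1 DV ∧ Set.EqOn (f c).2 (f d).2 DE ∧ φ c = φ d) :
    IsSupportedOn (relabelOp f * diagOp φ) DV DE := by
  have hval : ∀ c c' : Config V E G, ((relabelOp f * diagOp φ) (ket c)) c' =
      if c' = f c then φ c else 0 := fun c c' => by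
    rw [relabelOp_mul_diagOp_ket]
    simp [ket, PiLp.single_apply]
  have htrans : ∀ c c' d d' : Config V E G, Set.EqOn c.1 d.1 DV → Set.EqOn c.2 d.2 DE →
      Set.EqOn c'.1 d'.1 DV → Set.EqOn c'.2 d'.2 DE →
      Set.EqOn d.1 d'.1 DVᶜ → Set.EqOn d.2 d'.2 DEᶜ → c' = f c → d' = f d := by
    rintro c c' d d' h1 h2 h3 h4 h5 h6 rfl
    obtain ⟨k1, k2, -⟩ := hin c d h1 h2
    refine Prod.ext (funext fun v => ?_) (funext fun e => ?_)
    · by_cases hv : v ∈ DV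
      · rw [← h3 hv, k1 hv]
      · rw [← h5 hv, (hout d).1 hv]
    · by_cases he : e ∈ DE
      · rw [← h4 he, k2 he]
      · rw [← h6 he, (hout d).2 he]
  refine ⟨fun c c' h => ?_, fun c c' d d' h1 h2 h3 h4 h5 h6 h7 h8 => ?_⟩
  · rw [hval] at h
    have hc : c' = f c := by
      by_contra hne
      exact h (if_neg hne)
    exact hc ▸ ⟨(hout c).1.symm, (hout c).2.symm⟩
  · rw [hval, hval, (hin c d h1 h2).2.2]
    have : c' = f c ↔ d' = f d := ⟨htrans c c' d d' h1 h2 h3 h4 h7 h8,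
      htrans d d' c c' h1.symm h2.symm h3.symm h4.symm h5 h6⟩
    simp only [this]

namespace BranchedTriangulation

variable [Group G] {F : Type*} (T : BranchedTriangulation V E F)

theorem noncommProd_gaugeOp_ket (R : Finset V) (x : G) (c : Config V E G)
    (hR : (R : Set V).Pairwise (Function.onFun Commute fun v => T.gaugeOp v x)) :
    R.noncommProd (fun v => T.gaugeOp v x) hR (ket c) =
      ket (fun w => if w ∈ R then c.1 w * x⁻¹ else c.1 w,
        fun e => (if T.tgt e ∈ R then x else 1) * c.2 e * (if T.src e ∈ R then x⁻¹ else 1)) := by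
  induction R using Finset.induction_on with
  | empty => simp
  | insert v R hv ih =>
    rw [Finset.noncommProd_insert_of_notMem _ _ _ _ hv, Module.End.mul_apply, ih, gaugeOp,
      relabelOp_ket]
    congr 1
    refine Prod.ext (funext fun w => ?_) (funext fun e => ?_)
    · by_cases h : w = v
      · subst h; simp [gaugeConfig, hv]
      · simp [gaugeConfig, h]
    · have h1 : ∀ u, u = v → u ∉ R := fun u h => h ▸ hv
      by_cases ht : T.tgt e = v <;> by_cases hs : T.src e = v
      · simp [gaugeConfig, ht, hs, hv]
      · simp [gaugeConfig, ht, hs, hv, mul_assoc]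
      · simp [gaugeConfig, ht, hs, hv, mul_assoc]
      · simp [gaugeConfig, ht, hs]

theorem gaugeRegionOp_ket (R : Finset V) (x : G) (c : Config V E G) :
    T.gaugeRegionOp R x (ket c) =
      ket (fun w => if w ∈ R then c.1 w * x⁻¹ else c.1 w,
        fun e => (if T.tgt e ∈ R then x else 1) * c.2 e * (if T.src e ∈ R then x⁻¹ else 1)) :=
  T.noncommProd_gaugeOp_ket R x c _

variable [Fintype F]

theorem sptPreState_eq {V E F G : Type*} [Fintype V] [DecidableEq V] [Fintype E] [Fintype G]
    [DecidableEq G] [Group G] [Fintype F] (T : BranchedTriangulation V E F)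
    (ω : G → G → G → Circle) : T.sptPreState ω = ∑ g : V → G, (T.sptPhase ω g : ℂ) • ket (g, fun _ : E => (1 : G)) := rfl

namespace BoundaryLoop

variable {T} {R : Finset V} (b : T.BoundaryLoop R)

theorem branchLineTilde_ket (ω : G → G → G → Circle) (x : G) (c : Config V E G) :
    b.branchLineTilde ω x (ket c) =
      ((b.phaseW ω x c * b.phaseThetaTilde ω x c : Circle) : ℂ) • ket (b.shift x c) :=
  relabelOp_mul_diagOp_ket _ _ _

theorem branchLine_ket (ω : G → G → G → Circle) (x g : G) (c : Config V E G) :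
    b.branchLine ω x g (ket c) = (((b.phaseW ω x c * b.phaseTheta ω x c : Circle) : ℂ) *
      (if g = b.dressedHolonomy c then 1 else 0)) • ket (b.shift x c) :=
  relabelOp_mul_diagOp_ket _ _ _

theorem branchLineTilde_mul_ket {ω : G → G → G → Circle} (hω : IsThreeCocycle ω) (x y : G)
    {c : Config V E G} (hc : FlatNearLoop T R c) (h : b.holonomy c = 1) :
    (b.branchLineTilde ω x * b.branchLineTilde ω y) (ket c) =
      b.branchLineTilde ω (x * y) (ket c) := by
  rw [Module.End.mul_apply, branchLineTilde_ket, map_smul, branchLineTilde_ket,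
    branchLineTilde_ket, shift_shift, smul_smul, ← b.phaseW_mul_phaseThetaTilde_mul hω x y hc h,
    mul_comm, ← Circle.coe_mul]

theorem branchLine_mul_ket {ω : G → G → G → Circle} (hω : IsThreeCocycle ω) {x y : G} (g g' : G)
    {c : Config V E G} (hc : FlatNearLoop T R c) (hx : Commute x (b.holonomy c))
    (hy : Commute y (b.holonomy c)) :
    (b.branchLine ω x g * b.branchLine ω y g') (ket c) =
      (if g = g' then (1 : ℂ) else 0) • (b.branchLine ω (x * y) g * b.gammaOp ω g x y) (ket c) := by
  rw [Module.End.mul_apply, Module.End.mul_apply, branchLine_ket, map_smul, branchLine_ket,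
    gammaOp, diagOp_ket, map_smul, branchLine_ket, shift_shift, dressedHolonomy_shift, smul_smul,
    smul_smul, smul_smul]
  by_cases h' : g' = b.dressedHolonomy c
  · by_cases hg : g = g'
    · have key := congrArg (fun z : Circle => (z : ℂ)) (b.phaseW_mul_phaseTheta_mul hω hc hx hy)
      rw [← h', ← hg, lift_ref, lift_ref] at key
      simp only [Circle.coe_mul] at key ⊢
      simp only [if_pos h', if_pos (hg.trans h'), if_pos hg, mul_one, one_mul]
      congr 1
      linear_combination key
    · have hne : ¬ g = b.dressedHolonomy c := fun h => hg (h.trans h'.symm)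
      simp [hg, hne]
  · by_cases hg : g = g'
    · subst hg
      simp [h']
    · simp [h', hg]

theorem isSupportedOn_branchLineTilde (ω : G → G → G → Circle) (x : G) :
    IsSupportedOn (b.branchLineTilde ω x) b.supportVertices b.supportEdges := by
  refine isSupportedOn_relabelOp_mul_diagOp (fun c => ⟨fun v _ => rfl, fun e he => ?_⟩)
    fun c d hV hE => ⟨hV, b.shift_eqOn hE x, ?_⟩
  · exact b.shift_snd_of_not_edgeCrosses x c fun h => he (b.mem_supportEdges_of_edgeCrosses h)
  · rw [b.phaseW_eq_of_eqOn hV hE, b.phaseThetaTilde_eq_of_eqOn hV hE]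

theorem branchLineTilde_sptPreState {ω : G → G → G → Circle} (hω : IsThreeCocycle ω) (x : G) :
    b.branchLineTilde ω x (T.sptPreState ω) = T.gaugeRegionOp R x (T.sptPreState ω) := by
  simp only [sptPreState_eq, map_sum, map_smul, branchLineTilde_ket, gaugeRegionOp_ket, smul_smul,
    ← Circle.coe_mul, ← b.sptPhase_mulRegion hω, shift_one_eq]
  let u : V → G := fun v => if v ∈ R then x else 1
  have hu : ∀ g : V → G, g * u = mulRegion R x g := fun g => by
    funext v
    by_cases h : v ∈ R <;> simp [u, mulRegion, h]
  -- Change of variables `g ↦ g u`: the coefficient of the gauge transformed state at `g` is the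
  -- original amplitude at `g u`.
  refine Fintype.sum_equiv (Equiv.mulRight u) _ _ fun g => ?_
  have hg : (fun v => if v ∈ R then mulRegion R x g v * x⁻¹ else mulRegion R x g v) = g := by
    funext v
    by_cases h : v ∈ R <;> simp [mulRegion, h]
  simp only [Equiv.coe_mulRight, hu, hg]

end BoundaryLoop

end BranchedTriangulation

end Operators

theorem mainTheorem3 {G : Type*} [Group G] [Fintype G] [DecidableEq G]
    {V E F : Type*} [Fintype V] [DecidableEq V] [Fintype E] [DecidableEq E] [Fintype F]
    (ω : G → G → G → Circle) (hω : IsThreeCocycle ω)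
    (T : BranchedTriangulation V E F) (R : Finset V) (b : T.BoundaryLoop R) :
    -- the slant product identity
    (∀ g h x y : G,
      slantTheta ω g x y * slantTheta ω h x y * slantGamma ω x g h *
          slantGamma ω y (x⁻¹ * g * x) (x⁻¹ * h * x) =
        slantTheta ω (g * h) x y * slantGamma ω (x * y) g h) ∧
    -- the operator acts only near the boundary and reproduces the gauge transformation
    (∀ x : G,
      IsSupportedOn (b.branchLineTilde ω x) b.supportVertices b.supportEdges ∧
      b.branchLineTilde ω x (T.sptPreState ω) = T.gaugeRegionOp R x (T.sptPreState ω)) ∧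
    -- group multiplication on states with trivial edges
    (∀ x y : G,
      ∀ ψ ∈ BranchedTriangulation.BoundaryLoop.trivialEdgeStates V E G,
        (b.branchLineTilde ω x * b.branchLineTilde ω y) ψ = b.branchLineTilde ω (x * y) ψ) ∧
    -- and on all states without flux
    (∀ x y : G, ∀ ψ ∈ b.fluxFreeStates,
        (b.branchLineTilde ω x * b.branchLineTilde ω y) ψ = b.branchLineTilde ω (x * y) ψ) ∧
    -- twisted multiplication for holonomies in the centralisers
    (∀ x y g g' : G, ∀ ψ ∈ b.centralFluxStates x y,
        (b.branchLine ω x g * b.branchLine ω y g') ψ =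
          (if g = g' then (1 : ℂ) else 0) •
            (b.branchLine ω (x * y) g * b.gammaOp ω g x y) ψ) := by
  have tilde : ∀ x y : G, ∀ ψ ∈ b.fluxFreeStates,
      (b.branchLineTilde ω x * b.branchLineTilde ω y) ψ = b.branchLineTilde ω (x * y) ψ := by
    intro x y
    refine LinearMap.eqOn_span ?_
    rintro ψ ⟨c, hc, h, rfl⟩
    exact b.branchLineTilde_mul_ket hω x y hc h
  refine ⟨fun g h x y => slantTheta_mul_slantGamma hω g h x y, fun x =>
    ⟨b.isSupportedOn_branchLineTilde ω x, b.branchLineTilde_sptPreState hω x⟩,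
    fun x y ψ hψ => tilde x y ψ ?_, tilde, fun x y g g' => ?_⟩
  -- Basis states with trivial edges are flat with trivial holonomy, so this is a special case of
  -- the flux free statement.
  · refine Submodule.span_mono ?_ hψ
    rintro ψ ⟨g, rfl⟩
    exact ⟨_, BranchedTriangulation.BoundaryLoop.flatNearLoop_one g, b.holonomy_one g, rfl⟩
  · refine LinearMap.eqOn_span
      (g := (if g = g' then (1 : ℂ) else 0) • (b.branchLine ω (x * y) g * b.gammaOp ω g x y)) ?_
    rintro ψ ⟨c, hc, hx, hy, rfl⟩
    exact b.branchLine_mul_ket hω g g' hc hx hy
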